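/- Let $(M,g)$ be a non-empty smooth three-dimensional Lorentzian manifold. Let $\eta$ be the inner product on $V=\mathbb R^3$ with $\eta_{02}=\eta_{20}=-1$, $\eta_{11}=\tfrac12$ and all other components zero. A null triad at $x$ is a basis $(e_0,e_1,e_2)$ of $T_xM$ with $g(e_a,e_b)=\eta_{ab}$. For $p\ge 0$ let $R^{(p)}=(R_{abcd},R_{abcd;e_1},\dots,R_{abcd;e_1\dots e_p})$, with values in $\mathcal R^p=\bigoplus_{j=0}^p\otimes^{4+j}V^*$, denote the components of the curvature tensor and of its first $p$ covariant derivatives relative to a null triad, and let $\hat R^{(p)}:O(\eta,M)\to\mathcal R^p$ be the corresponding map on the bundle of all null triads. The manifold is fully regular if $\hat R^{(p)}$ has constant rank $r_p$ for every $p\ge 0$; then, with $r_{-1}=0$, $q$ denotes the smallest integer with $r_{q-1}=r_q$. A $p$-th order normalizing cross-section is a submanifold $S\subset\mathcal R^p$ with a subgroup $G_p\subset O(\eta)$ such that (N1) $G_p$ fixes $S$ pointwise; (N2) if $X\in O(\eta)$ and $X(S)\cap S\ne\emptyset$ then $X\in G_p$; (N3) $M$ is covered by smooth moving null triads relative to which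 $R^{(p)}$ takes values in $S$. The manifold is curvature regular if such a cross-section exists for every $p$; then $s_p=\dim G_p$, and $t_p$ is the rank of $R^{(p)}$, as a map on open subsets of $M$, relative to the moving null triads of (N3). A fully regular, curvature regular manifold is properly $\mathrm{CH}_0$ (properly curvature homogeneous of order $0$) if $t_0=0$ and $t_1>0$, and it has $k$-th order pseudo-stabilization ($k\ge 1$) if $s_k=s_{k-1}>s_q$. Write $S_{ab}=R_{ab}-\tfrac13 R\,g_{ab}$ for the trace-free Ricci tensor, and $\Psi_0=S_{00}$, $\Psi_1=S_{01}$, $\Psi_2=S_{02}=S_{11}$, $\Psi_3=S_{12}$, $\Psi_4=S_{22}$ for its components in a null triad. The manifold is of type D if at every point, for a null triad with $\Psi_4\neq 0$, the quartic $\Psi_0+4\Psi_1z+6\Psi_2z^2+4\Psi_3z^3+\Psi_4z^4$ has two distinct real double roots. **Proposition.** There does not exist a non-empty, fully regular and curvature regular three-dimensional Lorentzian manifold that is of type D, is properly $\mathrm{CH}_0$, and has $k$-th order pseudo-stabilization for some $k\ge1$. -/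

import Mathlib

open scoped Manifold ContDiff Bundle

namespace CurvHom

noncomputable section

/-! ### Linear algebra of the model space

The model is a three-dimensional space with basis `e₀ = ℓ`, `e₁ = m`, `e₂ = n` and
`η(ℓ, n) = -1`, `η(m, m) = 1/2`, all other inner products of basis vectors being zero. -/

/-- The Gram matrix `η_{ab}` of a null triad. -/
def eta : Matrix (Fin 3) (Fin 3) ℝ := !![0, 0, -1; 0, 1 / 2, 0; -1, 0, 0]

/-- The inverse matrix `η^{ab}`. -/
def etaInv : Matrix (Fin 3) (Fin 3) ℝ := !![0, 0, -1; 0, 2, 0; -1, 0, 0]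

theorem eta_mul_etaInv : eta * etaInv = 1 := by
  ext i j
  fin_cases i <;> fin_cases j <;> simp [eta, etaInv, Matrix.mul_apply, Fin.sum_univ_three]

/-- The full Lorentz group `O(η)`. -/
def lorentzGroup : Subgroup (GL (Fin 3) ℝ) where
  carrier := {X | (X : Matrix (Fin 3) (Fin 3) ℝ).transpose * eta * X = eta}
  one_mem' := by simp
  mul_mem' := by
    intro X Y hX hY
    simp only [Set.mem_ofPred_eq] at hX hY ⊢
    calc ((X * Y : GL (Fin 3) ℝ) : Matrix (Fin 3) (Fin 3) ℝ).transpose * eta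
          * ((X * Y : GL (Fin 3) ℝ) : Matrix (Fin 3) (Fin 3) ℝ)
        = (Y : Matrix (Fin 3) (Fin 3) ℝ).transpose
          * ((X : Matrix (Fin 3) (Fin 3) ℝ).transpose * eta * X) * Y := by
          simp [Matrix.transpose_mul, Matrix.mul_assoc]
      _ = eta := by rw [hX, hY]
  inv_mem' := by
    intro X hX
    simp only [Set.mem_ofPred_eq] at hX ⊢
    have h1 : (X : Matrix (Fin 3) (Fin 3) ℝ) * ((X⁻¹ : GL (Fin 3) ℝ) : Matrix _ _ ℝ) = 1 :=
      X.mul_inv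
    have h2 : ((X⁻¹ : GL (Fin 3) ℝ) : Matrix (Fin 3) (Fin 3) ℝ).transpose
        * (X : Matrix (Fin 3) (Fin 3) ℝ).transpose = 1 := by
      rw [← Matrix.transpose_mul, h1, Matrix.transpose_one]
    calc ((X⁻¹ : GL (Fin 3) ℝ) : Matrix (Fin 3) (Fin 3) ℝ).transpose * eta
          * ((X⁻¹ : GL (Fin 3) ℝ) : Matrix (Fin 3) (Fin 3) ℝ)
        = ((X⁻¹ : GL (Fin 3) ℝ) : Matrix (Fin 3) (Fin 3) ℝ).transpose
          * ((X : Matrix (Fin 3) (Fin 3) ℝ).transpose * eta * X)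
          * ((X⁻¹ : GL (Fin 3) ℝ) : Matrix (Fin 3) (Fin 3) ℝ) := by rw [hX]
      _ = (((X⁻¹ : GL (Fin 3) ℝ) : Matrix (Fin 3) (Fin 3) ℝ).transpose
          * (X : Matrix (Fin 3) (Fin 3) ℝ).transpose) * eta
          * ((X : Matrix (Fin 3) (Fin 3) ℝ)
            * ((X⁻¹ : GL (Fin 3) ℝ) : Matrix (Fin 3) (Fin 3) ℝ)) := by
          simp only [Matrix.mul_assoc]
      _ = eta := by rw [h1, h2]; simp

/-- The Lie algebra `𝔬(η)` of infinitesimal isometries of `η`. -/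
def lorentzAlgebra : Submodule ℝ (Fin 3 → Fin 3 → ℝ) where
  carrier := {A | (Matrix.of A).transpose * eta + eta * Matrix.of A = 0}
  add_mem' := by
    intro A B hA hB
    simp only [Set.mem_ofPred_eq] at hA hB ⊢
    have : (Matrix.of (A + B) : Matrix (Fin 3) (Fin 3) ℝ) = Matrix.of A + Matrix.of B := rfl
    rw [this, Matrix.transpose_add, Matrix.add_mul, Matrix.mul_add,
      add_add_add_comm, hA, hB, add_zero]
  zero_mem' := by
    have : (Matrix.of (0 : Fin 3 → Fin 3 → ℝ) : Matrix (Fin 3) (Fin 3) ℝ) = 0 := rfl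
    simp [this]
  smul_mem' := by
    intro c A hA
    simp only [Set.mem_ofPred_eq] at hA ⊢
    have : (Matrix.of (c • A) : Matrix (Fin 3) (Fin 3) ℝ) = c • Matrix.of A := rfl
    rw [this, Matrix.transpose_smul, Matrix.smul_mul, Matrix.mul_smul, ← smul_add, hA, smul_zero]

/-- The space `𝓡^p = ⊗⁴V* ⊕ ⋯ ⊕ ⊗^{4+p}V*`, an element being an array of components
`(R_{abcd}, R_{abcd;e₁}, …, R_{abcd;e₁…e_p})`. -/
abbrev CurvSpace (p : ℕ) : Type := (j : Fin (p + 1)) → (Fin (4 + (j : ℕ)) → Fin 3) → ℝ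

/-- Change of components of covariant tensors when the basis `(e_a)` is replaced by
`e'_a = ∑_b X_{ba} e_b`. -/
def pull {p : ℕ} (X : Matrix (Fin 3) (Fin 3) ℝ) (T : CurvSpace p) : CurvSpace p :=
  fun j a => ∑ b : Fin (4 + (j : ℕ)) → Fin 3, (∏ i, X (b i) (a i)) * T j b

/-- The (left) action of a linear transformation on covariant tensors. -/
def act {p : ℕ} (X : GL (Fin 3) ℝ) (T : CurvSpace p) : CurvSpace p :=
  pull ((X⁻¹ : GL (Fin 3) ℝ) : Matrix (Fin 3) (Fin 3) ℝ) T

/-- The dimension of a (closed) subgroup of `GL(3, ℝ)`: the dimension of its Lie algebra, which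
consists of the generators of its one-parameter subgroups. -/
def lieDim (G : Subgroup (GL (Fin 3) ℝ)) : ℕ :=
  Module.finrank ℝ (Submodule.span ℝ
    {A : Matrix (Fin 3) (Fin 3) ℝ |
      ∀ t : ℝ, ∃ X ∈ G, (X : Matrix (Fin 3) (Fin 3) ℝ) = NormedSpace.exp (t • A)})

/-- `S` is an (injectively immersed, possibly embedded) smooth submanifold of the normed space
`W`. -/
def IsSubmanifold {W : Type} [NormedAddCommGroup W] [NormedSpace ℝ W] (S : Set W) : Prop :=
  ∃ (d : ℕ) (N : Type) (_ : TopologicalSpace N)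
    (_ : ChartedSpace (EuclideanSpace ℝ (Fin d)) N) (f : N → W),
    IsManifold (𝓡 d) ∞ N ∧ T2Space N ∧ SecondCountableTopology N ∧
    ContMDiff (𝓡 d) 𝓘(ℝ, W) ∞ f ∧ Function.Injective f ∧
    (∀ y, Function.Injective (mfderiv (𝓡 d) 𝓘(ℝ, W) f y)) ∧ Set.range f = S

/-! ### Lorentzian metrics on three-manifolds and their curvature -/

section Manifold

variable {M : Type*} [TopologicalSpace M] [ChartedSpace (EuclideanSpace ℝ (Fin 3)) M]

/-- Vector fields (with no regularity imposed). -/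
abbrev VField (M : Type*) [TopologicalSpace M] [ChartedSpace (EuclideanSpace ℝ (Fin 3)) M] :
    Type _ :=
  (x : M) → TangentSpace (𝓡 3) x

variable [IsManifold (𝓡 3) ∞ M]

/-- A smooth Lorentzian metric (signature `(-,+,+)`) on a smooth three-manifold. -/
structure LorentzMetric (M : Type*) [TopologicalSpace M]
    [ChartedSpace (EuclideanSpace ℝ (Fin 3)) M] [IsManifold (𝓡 3) ∞ M] where
  val : (x : M) → TangentSpace (𝓡 3) x →L[ℝ] TangentSpace (𝓡 3) x →L[ℝ] ℝ
  symm : ∀ (x : M) (v w : TangentSpace (𝓡 3) x), val x v w = val x w v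
  lorentzian : ∀ x : M, ∃ b : Fin 3 → TangentSpace (𝓡 3) x,
    ∀ a c, val x (b a) (b c) = eta a c
  smooth : ContMDiff (𝓡 3)
    ((𝓡 3).prod 𝓘(ℝ, EuclideanSpace ℝ (Fin 3) →L[ℝ] EuclideanSpace ℝ (Fin 3) →L[ℝ] ℝ)) ∞
    (fun x => Bundle.TotalSpace.mk'
      (EuclideanSpace ℝ (Fin 3) →L[ℝ] EuclideanSpace ℝ (Fin 3) →L[ℝ] ℝ)
      (E := fun x : M => TangentSpace (𝓡 3) x →L[ℝ] TangentSpace (𝓡 3) x →L[ℝ] ℝ) x (val x))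

/-- The derivative `X(f)` of a function along a vector field. -/
def dirDeriv (X : VField M) (f : M → ℝ) (x : M) : ℝ := mvfderiv (𝓡 3) f x (X x)

/-- Differentiability of a vector field at a point. -/
def VDiffAt (X : VField M) (x : M) : Prop :=
  MDifferentiableAt (𝓡 3) (𝓡 3).tangent (fun y => (⟨y, X y⟩ : TangentBundle (𝓡 3) M)) x

/-- Half the right-hand side of the Koszul formula. -/
def koszul (g : LorentzMetric M) (X Y Z : VField M) (x : M) : ℝ :=
  (1 / 2) * (dirDeriv X (fun y => g.val y (Y y) (Z y)) x
    + dirDeriv Y (fun y => g.val y (X y) (Z y)) x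
    - dirDeriv Z (fun y => g.val y (X y) (Y y)) x
    + g.val x (VectorField.mlieBracket (𝓡 3) X Y x) (Z x)
    - g.val x (VectorField.mlieBracket (𝓡 3) X Z x) (Y x)
    - g.val x (VectorField.mlieBracket (𝓡 3) Y Z x) (X x))

theorem LorentzMetric.mdifferentiableAt_apply (g : LorentzMetric M) {Y Z : VField M} {x : M}
    (hY : VDiffAt Y x) (hZ : VDiffAt Z x) :
    MDifferentiableAt (𝓡 3) 𝓘(ℝ, ℝ) (fun y => g.val y (Y y) (Z y)) x := by
  have h := MDifferentiableAt.clm_bundle_apply₂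
    (F₁ := EuclideanSpace ℝ (Fin 3)) (F₂ := EuclideanSpace ℝ (Fin 3)) (F₃ := ℝ)
    (E₁ := fun x : M => TangentSpace (𝓡 3) x) (E₂ := fun x : M => TangentSpace (𝓡 3) x)
    (E₃ := fun _ : M => ℝ) (b := fun x : M => x)
    ((g.smooth x).mdifferentiableAt (by simp)) hY hZ
  simpa using (mdifferentiableAt_section _ _).1 h

theorem LorentzMetric.nondegenerate (g : LorentzMetric M) (x : M) (v : TangentSpace (𝓡 3) x)
    (h : ∀ w, g.val x v w = 0) : v = 0 := by
  obtain ⟨b, hb⟩ := g.lorentzian x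
  have key : ∀ c : Fin 3 → ℝ, (∀ d, g.val x (∑ a, c a • b a) (b d) = 0) → ∀ a, c a = 0 := by
    intro c hc
    have h0 := hc 0
    have h1 := hc 1
    have h2 := hc 2
    simp [Fin.sum_univ_three, hb, eta] at h0 h1 h2
    intro a
    fin_cases a <;> simp [h0, h1, h2]
  have hli : LinearIndependent ℝ b := by
    rw [Fintype.linearIndependent_iff]
    intro c hc
    exact key c (fun d => by rw [hc]; simp)
  have hcard : Fintype.card (Fin 3) = Module.finrank ℝ (TangentSpace (𝓡 3) x) := by
    change _ = Module.finrank ℝ (EuclideanSpace ℝ (Fin 3))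
    simp
  have hv := (basisOfLinearIndependentOfCardEqFinrank hli hcard).sum_repr v
  simp only [coe_basisOfLinearIndependentOfCardEqFinrank] at hv
  have hz := key _ (fun d => by rw [hv]; exact h (b d))
  rw [← hv]
  exact Finset.sum_eq_zero (fun a _ => by rw [hz a, zero_smul])

theorem koszul_tensorial (g : LorentzMetric M) (X Y : VField M) (x : M)
    (hX : VDiffAt X x) (hY : VDiffAt Y x) :
    TensorialAt (𝓡 3) (EuclideanSpace ℝ (Fin 3)) (fun Z => koszul g X Y Z x) x where
  smul := by
    intro f Z hf hZ
    have h1 := mvfderiv_fun_mul hf (g.mdifferentiableAt_apply hY hZ)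
    have h2 := mvfderiv_fun_mul hf (g.mdifferentiableAt_apply hX hZ)
    simp only [koszul, dirDeriv, Pi.smul_apply', map_smul, smul_eq_mul, h1, h2,
      VectorField.mlieBracket_smul_right hf hZ]
    simp
    rw [g.symm x (Z x) (X x), g.symm x (Z x) (Y x)]
    ring
  add := by
    intro Z Z' hZ hZ'
    have h1 := mvfderiv_fun_add (g.mdifferentiableAt_apply hY hZ) (g.mdifferentiableAt_apply hY hZ')
    have h2 := mvfderiv_fun_add (g.mdifferentiableAt_apply hX hZ) (g.mdifferentiableAt_apply hX hZ')
    simp only [koszul, dirDeriv, Pi.add_apply, map_add, h1, h2,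
      VectorField.mlieBracket_add_right hZ hZ']
    simp
    ring

open Classical in
/-- The Levi-Civita connection `∇_X Y`, defined by the Koszul formula: `(∇_X Y)_x` is the vector
with `g(∇_X Y, Z) = koszul X Y Z` at `x` for all `Z`. -/
def leviCivita (g : LorentzMetric M) (X Y : VField M) : VField M := fun x =>
  if h : ∃ v : TangentSpace (𝓡 3) x, ∀ Z : VField M, VDiffAt Z x →
      g.val x v (Z x) = koszul g X Y Z x
  then h.choose else 0

theorem leviCivita_spec (g : LorentzMetric M) (X Y : VField M) (x : M)
    (hX : VDiffAt X x) (hY : VDiffAt Y x) (Z : VField M) (hZ : VDiffAt Z x) :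
    g.val x (leviCivita g X Y x) (Z x) = koszul g X Y Z x := by
  have hex : ∃ v : TangentSpace (𝓡 3) x, ∀ Z : VField M, VDiffAt Z x →
      g.val x v (Z x) = koszul g X Y Z x := by
    have : FiniteDimensional ℝ (TangentSpace (𝓡 3) x) :=
      inferInstanceAs (FiniteDimensional ℝ (EuclideanSpace ℝ (Fin 3)))
    have hT := koszul_tensorial g X Y x hX hY
    let φ := TensorialAt.mkHom _ x hT
    let B : TangentSpace (𝓡 3) x →ₗ[ℝ] Module.Dual ℝ (TangentSpace (𝓡 3) x) :=
      LinearMap.mk₂ ℝ (fun v w => g.val x v w) (by simp) (by simp) (by simp) (by simp)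
    have hinj : Function.Injective B := by
      rw [injective_iff_map_eq_zero]
      intro v hv
      exact g.nondegenerate x v (fun w => DFunLike.congr_fun hv w)
    have hsurj : Function.Surjective B :=
      (LinearMap.injective_iff_surjective_of_finrank_eq_finrank
        (Subspace.dual_finrank_eq).symm).1 hinj
    obtain ⟨v, hv⟩ := hsurj φ.toLinearMap
    refine ⟨v, fun Z hZ => ?_⟩
    have h1 : g.val x v (Z x) = φ (Z x) := DFunLike.congr_fun hv (Z x)
    rw [h1]
    exact TensorialAt.mkHom_apply hT hZ
  unfold leviCivita
  rw [dif_pos hex]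
  exact hex.choose_spec Z hZ

/-- The curvature operator `R(X, Y)Z = ∇_X ∇_Y Z - ∇_Y ∇_X Z - ∇_{[X,Y]} Z`. -/
def curvOp (g : LorentzMetric M) (X Y Z : VField M) : VField M := fun x =>
  leviCivita g X (leviCivita g Y Z) x - leviCivita g Y (leviCivita g X Z) x
    - leviCivita g (VectorField.mlieBracket (𝓡 3) X Y) Z x

/-- The covariant tensors `∇^j R`, as functions of `4 + j` vector fields. For `j = 0`,
`R(W₀, W₁, W₂, W₃) = g(W₀, R(W₂, W₃)W₁)`, and
`(∇T)(W₀, …, W_{k-1}; W_k) = W_k(T(W₀, …, W_{k-1})) - ∑ᵢ T(W₀, …, ∇_{W_k} Wᵢ, …, W_{k-1})`. -/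
def curvDeriv (g : LorentzMetric M) : (j : ℕ) → (Fin (4 + j) → VField M) → M → ℝ
  | 0, W => fun x => g.val x (W 0 x) (curvOp g (W 2) (W 3) (W 1) x)
  | j + 1, W => fun x =>
      dirDeriv (W (Fin.last (4 + j))) (curvDeriv g j (fun i => W i.castSucc)) x
      - ∑ i : Fin (4 + j), curvDeriv g j
          (Function.update (fun i => W i.castSucc) i
            (leviCivita g (W (Fin.last (4 + j))) (W i.castSucc))) x

/-- A smooth `η`-orthonormal moving frame `e = (ℓ, m, n)` on the open set `U` (equivalently, its
dual moving coframe). Values outside `U` are irrelevant. -/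
structure IsMovingFrame (g : LorentzMetric M) (U : Set M) (e : Fin 3 → VField M) : Prop where
  isOpen : IsOpen U
  smooth : ∀ a, ContMDiffOn (𝓡 3) (𝓡 3).tangent ∞
    (fun x => (⟨x, e a x⟩ : TangentBundle (𝓡 3) M)) U
  orthonormal : ∀ x ∈ U, ∀ a b, g.val x (e a x) (e b x) = eta a b

/-- The components `R^{(p)} = (R_{abcd}, …, R_{abcd;e₁…e_p})` relative to a moving frame. -/
def curvComp (g : LorentzMetric M) (p : ℕ) (e : Fin 3 → VField M) (x : M) : CurvSpace p :=
  fun j a => curvDeriv g (j : ℕ) (fun i => e (a i)) x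

/-! ### Full regularity -/

/-- The lift `R̂^{(p)}` of `R^{(p)}` to the orthonormal frame bundle, in the local trivialization
given by the moving frame `e`: the pair `(x, X)` with `X ∈ O(η)` stands for the frame
`e'_a = ∑_b X_{ba} e_b` at `x`. -/
def liftedCurv (g : LorentzMetric M) (p : ℕ) (e : Fin 3 → VField M)
    (z : M × (Fin 3 → Fin 3 → ℝ)) : CurvSpace p :=
  pull (Matrix.of z.2) (curvComp g p e z.1)

/-- The rank of `R̂^{(p)}` at the frame `e(x)`: the dimension of the image under the differential
of the tangent space `T_xM ⊕ 𝔬(η)` of the orthonormal frame bundle. -/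
def liftedRank (g : LorentzMetric M) (p : ℕ) (e : Fin 3 → VField M) (x : M) : ℕ :=
  Module.finrank ℝ (Submodule.map
    (mvfderiv ((𝓡 3).prod 𝓘(ℝ, Fin 3 → Fin 3 → ℝ)) (liftedCurv g p e)
      (x, fun a b => (1 : Matrix (Fin 3) (Fin 3) ℝ) a b)).toLinearMap
    (Submodule.prod (⊤ : Submodule ℝ (EuclideanSpace ℝ (Fin 3))) lorentzAlgebra))

/-- `R̂^{(p)}` has constant rank `r_p = r`. -/
def HasRank (g : LorentzMetric M) (p r : ℕ) : Prop :=
  ∀ (U : Set M) (e : Fin 3 → VField M), IsMovingFrame g U e → ∀ x ∈ U, liftedRank g p e x = r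

/-- Full regularity: every `R̂^{(p)}` has constant rank. -/
def FullyRegular (g : LorentzMetric M) : Prop := ∀ p, ∃ r, HasRank g p r

/-- `q` is the smallest integer with `r_{q-1} = r_q`, where `r_{-1} = 0`. The sequence `ρ` is the
shifted rank sequence, `ρ (p + 1) = r_p`. -/
def IsStableIndex (g : LorentzMetric M) (q : ℕ) : Prop :=
  ∃ ρ : ℕ → ℕ, ρ 0 = 0 ∧ (∀ p, HasRank g p (ρ (p + 1))) ∧ IsLeast {k | ρ k = ρ (k + 1)} q

/-! ### Curvature regularity, curvature homogeneity, pseudo-stabilization -/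

/-- `S` is a normalizing cross-section of order `p` for `(M, g)`, with subgroup `G_p = G`. -/
structure IsNormalizing (g : LorentzMetric M) (p : ℕ) (S : Set (CurvSpace p))
    (G : Subgroup (GL (Fin 3) ℝ)) : Prop where
  submanifold : IsSubmanifold S
  le : G ≤ lorentzGroup
  fixes : ∀ X ∈ G, ∀ T ∈ S, act X T = T
  maximal : ∀ X ∈ lorentzGroup, (act X '' S ∩ S).Nonempty → X ∈ G
  cover : ∀ x : M, ∃ (U : Set M) (e : Fin 3 → VField M), IsMovingFrame g U e ∧ x ∈ U ∧
    ∀ y ∈ U, curvComp g p e y ∈ S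

/-- Curvature regularity: normalizing cross-sections exist in every order. -/
def CurvatureRegular (g : LorentzMetric M) : Prop := ∀ p, ∃ S G, IsNormalizing g p S G

/-- `s_p = s`: the degree of frame freedom of order `p` is `s = dim G_p`. -/
def HasFrameFreedom (g : LorentzMetric M) (p s : ℕ) : Prop :=
  ∃ S G, IsNormalizing g p S G ∧ lieDim G = s

/-- `t_p = t`: the rank of the normalized components `R^{(p)}`, as functions on `M`, is `t`.
The rank of a smooth map is the largest rank attained by its differential (for the fully regular
metrics considered below, the rank of `R^{(p)}` is supposed not to depend on the point at all). -/
def HasHorizontalRank (g : LorentzMetric M) (p t : ℕ) : Prop :=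
  ∃ S G, IsNormalizing g p S G ∧
    IsGreatest {k | ∃ (U : Set M) (e : Fin 3 → VField M), IsMovingFrame g U e ∧
      (∀ y ∈ U, curvComp g p e y ∈ S) ∧ ∃ x ∈ U,
        k = Module.finrank ℝ
          (LinearMap.range (mvfderiv (𝓡 3) (curvComp g p e) x).toLinearMap)} t

/-- Curvature homogeneity of order `k`. -/
def IsCH (g : LorentzMetric M) (k : ℕ) : Prop :=
  FullyRegular g ∧ CurvatureRegular g ∧ HasHorizontalRank g k 0

/-- Proper curvature homogeneity of order `k`: `t_k = 0` and `t_{k+1} > 0`. -/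
def IsProperlyCH (g : LorentzMetric M) (k : ℕ) : Prop :=
  IsCH g k ∧ ∃ t, 0 < t ∧ HasHorizontalRank g (k + 1) t

/-- Pseudo-stabilization of order `k ≥ 1`: `s_k = s_{k-1} > s_q`. -/
def PseudoStable (g : LorentzMetric M) (k : ℕ) : Prop :=
  FullyRegular g ∧ CurvatureRegular g ∧ 1 ≤ k ∧ ∃ s s' q, HasFrameFreedom g k s ∧
    HasFrameFreedom g (k - 1) s ∧ IsStableIndex g q ∧ HasFrameFreedom g q s' ∧ s' < s

/-! ### Petrov type D -/

/-- The frame components `R_{ab} = R^c_{acb}` of the Ricci tensor. -/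
def ricci (g : LorentzMetric M) (e : Fin 3 → VField M) (x : M) (a b : Fin 3) : ℝ :=
  ∑ c, ∑ d, etaInv c d * curvDeriv g 0 ![e d, e a, e c, e b] x

/-- The scalar curvature `R = R^a_a`. -/
def scalarCurv (g : LorentzMetric M) (e : Fin 3 → VField M) (x : M) : ℝ :=
  ∑ a, ∑ b, etaInv a b * ricci g e x a b

/-- The trace-free part `S_{ab} = R_{ab} - (R/3) g_{ab}` of the Ricci tensor. Its components are
`S₀₀ = Ψ₀`, `S₀₁ = Ψ₁`, `S₀₂ = S₁₁ = Ψ₂`, `S₁₂ = Ψ₃`, `S₂₂ = Ψ₄`. -/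
def tfRicci (g : LorentzMetric M) (e : Fin 3 → VField M) (x : M) (a b : Fin 3) : ℝ :=
  ricci g e x a b - scalarCurv g e x / 3 * eta a b

/-- The quartic `Ψ₀ + 4Ψ₁z + 6Ψ₂z² + 4Ψ₃z³ + Ψ₄z⁴`. -/
def petrovQuartic (g : LorentzMetric M) (e : Fin 3 → VField M) (x : M) (z : ℝ) : ℝ :=
  tfRicci g e x 0 0 + 4 * tfRicci g e x 0 1 * z + 6 * tfRicci g e x 0 2 * z ^ 2
    + 4 * tfRicci g e x 1 2 * z ^ 3 + tfRicci g e x 2 2 * z ^ 4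

/-- Petrov type D at `x`: for some null triad with `Ψ₄ ≠ 0` the quartic has two distinct real
double roots. -/
def IsTypeDAt (g : LorentzMetric M) (x : M) : Prop :=
  ∃ (U : Set M) (e : Fin 3 → VField M), IsMovingFrame g U e ∧ x ∈ U ∧
    tfRicci g e x 2 2 ≠ 0 ∧ ∃ α β : ℝ, α ≠ β ∧
      ∀ z, petrovQuartic g e x z = tfRicci g e x 2 2 * ((z - α) ^ 2 * (z - β) ^ 2)

/-- Petrov type D at every point. -/
def IsTypeD (g : LorentzMetric M) : Prop := ∀ x : M, IsTypeDAt g x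

end Manifold

end

end CurvHom

/-! Let `G` be the group of the cross-section of order `k`. Pseudo-stabilization makes its dimension
positive, and `k ≥ 1`, so a non-trivial one-parameter group of Lorentz transformations fixes the
components of both R and ∇R in a normalizing frame. In particular it fixes the Ricci tensor, whose
trace-free part is of type D and singles out two null directions. The only infinitesimal isometries
compatible with this are the boosts in the plane of those directions (`IsCanonical.eq_diagonal`).
After a constant change of frame, all components of R and ∇R of nonzero boost weight vanish on the
domain of the frame (`exists_boostInvariant_frame`).

Write ℓ, m, n for the new frame. R is determined by P = R₀₁₁₂ and Q = R₀₂₀₂, and type D gives Q + 2P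
≠ 0. The weighted components of ∇R are multiples of Q + 2P by connection components, so their
vanishing makes m geodesic, with ∇_ℓ m = bℓ and ∇_n m = an (`conn_eq_zero`). The rest of the
connection is its boost part w. Curvature homogeneity of order zero makes P and Q constant, since
they are locally determined by two scalar invariants of the Ricci tensor. By the structure
equations, a and b solve the same Riccati equation along m, with ℓ(a) = n(b) = 0. The identity d² =
0 applied to w becomes (a + b)(Q + 2P) = 0. Hence b = -a, and then a is constant (`twist_const`).

The boost part of the connection annihilates tensors of boost weight zero, so the components of ∇R
are polynomial in the constants a, P, Q and are constant too (`dirDeriv_curvDeriv_one`). By (N1) and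
(N2) a cross-section meets each Lorentz orbit at most once, so components that are constant in one
frame are constant in every normalizing frame of the same order (`IsNormalizing.eventually_const`).
This forces t₁ = 0, contrary to proper curvature homogeneity of order zero. -/

namespace CurvHom

noncomputable section

/-! ### Calculus of smooth functions and vector fields on an open set. -/

section SmoothFields

variable {M : Type*} [TopologicalSpace M] [ChartedSpace (EuclideanSpace ℝ (Fin 3)) M]

/-- Smoothness of a function on a set. -/
def SmoothFn (U : Set M) (f : M → ℝ) : Prop := ContMDiffOn (𝓡 3) 𝓘(ℝ, ℝ) ∞ f U

variable {U : Set M} {x : M} {f f' : M → ℝ} {X Y Z X' Y' : VField M}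

theorem SmoothFn.contMDiffAt (hf : SmoothFn U f) (hU : IsOpen U) (hx : x ∈ U) :
    ContMDiffAt (𝓡 3) 𝓘(ℝ, ℝ) ∞ f x := (hf x hx).contMDiffAt (hU.mem_nhds hx)

theorem SmoothFn.mdiff (hf : SmoothFn U f) (hU : IsOpen U) (hx : x ∈ U) :
    MDifferentiableAt (𝓡 3) 𝓘(ℝ, ℝ) f x :=
  (hf.contMDiffAt hU hx).mdifferentiableAt (by simp)

theorem SmoothFn.add (hf : SmoothFn U f) (hf' : SmoothFn U f') :
    SmoothFn U (fun x => f x + f' x) := ContMDiffOn.add hf hf'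

theorem SmoothFn.sub (hf : SmoothFn U f) (hf' : SmoothFn U f') :
    SmoothFn U (fun x => f x - f' x) := ContMDiffOn.sub hf hf'

theorem SmoothFn.mul (hf : SmoothFn U f) (hf' : SmoothFn U f') :
    SmoothFn U (fun x => f x * f' x) := ContMDiffOn.smul hf hf'

theorem smoothFn_const (c : ℝ) : SmoothFn U (fun _ => c) := contMDiffOn_const

theorem SmoothFn.neg (hf : SmoothFn U f) : SmoothFn U (fun x => -f x) := ContMDiffOn.neg hf

theorem SmoothFn.sum {ι : Type*} {s : Finset ι} {F : ι → M → ℝ} (h : ∀ i ∈ s, SmoothFn U (F i)) :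
    SmoothFn U (fun x => ∑ i ∈ s, F i x) := by
  classical
  induction s using Finset.induction_on with
  | empty => simpa using smoothFn_const 0
  | insert i s hi ih =>
    simp only [Finset.sum_insert hi]
    exact (h i (by simp)).add (ih fun j hj => h j (by simp [hj]))

theorem SmoothFn.congr (hf : SmoothFn U f) (h : ∀ x ∈ U, f' x = f x) : SmoothFn U f' :=
  ContMDiffOn.congr hf h

/-! #### Directional derivatives -/

theorem dirDeriv_congr (hU : IsOpen U) (hx : x ∈ U) (h : ∀ y ∈ U, f y = f' y) (X : VField M) :
    dirDeriv X f x = dirDeriv X f' x := by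
  have he : f =ᶠ[nhds x] f' := Filter.eventually_of_mem (hU.mem_nhds hx) h
  have := he.mfderiv_eq (I := 𝓡 3) (I' := 𝓘(ℝ, ℝ))
  simp only [dirDeriv, mvfderiv]
  have h0 := h x hx
  simp [this]
  rfl

theorem dirDeriv_add (hU : IsOpen U) (hx : x ∈ U) (hf : SmoothFn U f) (hf' : SmoothFn U f')
    (X : VField M) : dirDeriv X (fun y => f y + f' y) x = dirDeriv X f x + dirDeriv X f' x := by
  simp [dirDeriv, mvfderiv_fun_add (hf.mdiff hU hx) (hf'.mdiff hU hx)]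

theorem dirDeriv_sub (hU : IsOpen U) (hx : x ∈ U) (hf : SmoothFn U f) (hf' : SmoothFn U f')
    (X : VField M) : dirDeriv X (fun y => f y - f' y) x = dirDeriv X f x - dirDeriv X f' x := by
  simp [dirDeriv, mvfderiv_fun_sub (hf.mdiff hU hx) (hf'.mdiff hU hx)]

theorem dirDeriv_neg (X : VField M) (f : M → ℝ) (x : M) :
    dirDeriv X (fun y => -f y) x = -dirDeriv X f x := by
  simp [dirDeriv, mvfderiv_fun_neg]

theorem dirDeriv_mul (hU : IsOpen U) (hx : x ∈ U) (hf : SmoothFn U f) (hf' : SmoothFn U f')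
    (X : VField M) :
    dirDeriv X (fun y => f y * f' y) x = f x * dirDeriv X f' x + f' x * dirDeriv X f x := by
  simp [dirDeriv, mvfderiv_fun_mul (hf.mdiff hU hx) (hf'.mdiff hU hx)]

@[simp]
theorem dirDeriv_const (X : VField M) (c : ℝ) (x : M) : dirDeriv X (fun _ => c) x = 0 := by
  simp [dirDeriv, mvfderiv_const]

theorem dirDeriv_const_mul (hU : IsOpen U) (hx : x ∈ U) (hf : SmoothFn U f) (c : ℝ)
    (X : VField M) : dirDeriv X (fun y => c * f y) x = c * dirDeriv X f x := by
  rw [dirDeriv_mul hU hx (smoothFn_const c) hf]; simp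

theorem dirDeriv_eq_zero_of_const (hU : IsOpen U) (hx : x ∈ U) {c : ℝ} (h : ∀ y ∈ U, f y = c)
    (X : VField M) : dirDeriv X f x = 0 := by
  rw [dirDeriv_congr hU hx h]; simp

theorem dirDeriv_add_left (X Y : VField M) (f : M → ℝ) (x : M) :
    dirDeriv (X + Y) f x = dirDeriv X f x + dirDeriv Y f x := by
  simp [dirDeriv]

theorem dirDeriv_smul_left (h : M → ℝ) (X : VField M) (f : M → ℝ) (x : M) :
    dirDeriv (h • X) f x = h x * dirDeriv X f x := by
  simp [dirDeriv]

theorem dirDeriv_congr_left (h : X x = Y x) (f : M → ℝ) : dirDeriv X f x = dirDeriv Y f x := by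
  simp [dirDeriv, h]

/-! #### Brackets and smooth fields -/

/-- The Lie bracket of vector fields. -/
abbrev bracket (X Y : VField M) : VField M := VectorField.mlieBracket (𝓡 3) X Y

theorem bracket_swap (X Y : VField M) (x : M) : bracket X Y x = -bracket Y X x :=
  VectorField.mlieBracket_swap_apply

theorem bracket_congr (hU : IsOpen U) (hx : x ∈ U) (hX : ∀ y ∈ U, X y = X' y)
    (hY : ∀ y ∈ U, Y y = Y' y) : bracket X Y x = bracket X' Y' x :=
  Filter.EventuallyEq.mlieBracket_vectorField_eq (Filter.eventually_of_mem (hU.mem_nhds hx) hX)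
    (Filter.eventually_of_mem (hU.mem_nhds hx) hY)

variable [IsManifold (𝓡 3) ∞ M]

/-- Smoothness of a vector field on a set. -/
def SmoothField (U : Set M) (X : VField M) : Prop :=
  ContMDiffOn (𝓡 3) (𝓡 3).tangent ∞ (fun x => (⟨x, X x⟩ : TangentBundle (𝓡 3) M)) U

theorem SmoothField.contMDiffAt (hX : SmoothField U X) (hU : IsOpen U) (hx : x ∈ U) :
    ContMDiffAt (𝓡 3) (𝓡 3).tangent ∞ (fun x => (⟨x, X x⟩ : TangentBundle (𝓡 3) M)) x :=
  (hX x hx).contMDiffAt (hU.mem_nhds hx)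

theorem SmoothField.vdiff (hX : SmoothField U X) (hU : IsOpen U) (hx : x ∈ U) : VDiffAt X x :=
  (hX.contMDiffAt hU hx).mdifferentiableAt (by simp)

theorem SmoothField.add (hX : SmoothField U X) (hY : SmoothField U Y) : SmoothField U (X + Y) :=
  ContMDiffOn.add_section hX hY

theorem SmoothField.sub (hX : SmoothField U X) (hY : SmoothField U Y) : SmoothField U (X - Y) :=
  ContMDiffOn.sub_section hX hY

theorem SmoothField.smul (hf : SmoothFn U f) (hX : SmoothField U X) : SmoothField U (f • X) :=
  ContMDiffOn.smul_section hf hX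

theorem SmoothField.const_smul (c : ℝ) (hX : SmoothField U X) : SmoothField U (c • X) :=
  ContMDiffOn.const_smul_section hX

theorem smoothField_zero : SmoothField U (0 : VField M) :=
  Bundle.contMDiffOn_zeroSection ℝ _

theorem SmoothField.sum {ι : Type*} {s : Finset ι} {F : ι → VField M}
    (h : ∀ i ∈ s, SmoothField U (F i)) : SmoothField U (∑ i ∈ s, F i) := by
  classical
  induction s using Finset.induction_on with
  | empty => simpa using smoothField_zero
  | insert i s hi ih =>
    simp only [Finset.sum_insert hi]
    exact (h i (by simp)).add (ih fun j hj => h j (by simp [hj]))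

theorem SmoothField.congr (hX : SmoothField U X) (h : ∀ x ∈ U, X' x = X x) : SmoothField U X' :=
  ContMDiffOn.congr hX fun x hx => by rw [h x hx]

theorem SmoothField.bracket (hU : IsOpen U) (hX : SmoothField U X) (hY : SmoothField U Y) :
    SmoothField U (bracket X Y) := fun x hx => by
  have : IsManifold (𝓡 3) (minSmoothness ℝ 2) M := by
    rw [minSmoothness_of_isRCLikeNormedField]
    exact IsManifold.of_le (n := ∞) ((WithTop.coe_le_coe.2 (le_top : (2 : ℕ∞) ≤ ⊤)))
  have : IsManifold (𝓡 3) ((⊤ : ℕ∞) + 1) M := by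
    simpa using (inferInstance : IsManifold (𝓡 3) ∞ M)
  exact (ContMDiffAt.mlieBracket_vectorField (m := ⊤) (n := ⊤) (hX.contMDiffAt hU hx)
    (hY.contMDiffAt hU hx) (by simp)).contMDiffWithinAt

theorem bracket_smul_right (hU : IsOpen U) (hx : x ∈ U) (hf : SmoothFn U f)
    (hY : SmoothField U Y) (X : VField M) :
    bracket X (f • Y) x = dirDeriv X f x • Y x + f x • bracket X Y x :=
  VectorField.mlieBracket_smul_right (hf.mdiff hU hx) (hY.vdiff hU hx)

theorem bracket_smul_left (hU : IsOpen U) (hx : x ∈ U) (hf : SmoothFn U f)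
    (hX : SmoothField U X) (Y : VField M) :
    bracket (f • X) Y x = -dirDeriv Y f x • X x + f x • bracket X Y x := by
  have := VectorField.mlieBracket_smul_left (W := Y) (hf.mdiff hU hx) (hX.vdiff hU hx)
  exact this

theorem bracket_add_right (hU : IsOpen U) (hx : x ∈ U) (hY : SmoothField U Y)
    (hY' : SmoothField U Y') (X : VField M) :
    bracket X (Y + Y') x = bracket X Y x + bracket X Y' x :=
  VectorField.mlieBracket_add_right (hY.vdiff hU hx) (hY'.vdiff hU hx)

theorem bracket_add_left (hU : IsOpen U) (hx : x ∈ U) (hX : SmoothField U X)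
    (hX' : SmoothField U X') (Y : VField M) :
    bracket (X + X') Y x = bracket X Y x + bracket X' Y x :=
  VectorField.mlieBracket_add_left (hX.vdiff hU hx) (hX'.vdiff hU hx)

theorem bracket_jacobi (hU : IsOpen U) (hx : x ∈ U) (hX : SmoothField U X)
    (hY : SmoothField U Y) (hZ : SmoothField U Z) :
    bracket X (bracket Y Z) x = bracket (bracket X Y) Z x + bracket Y (bracket X Z) x := by
  have : IsManifold (𝓡 3) (minSmoothness ℝ 3) M := by
    rw [minSmoothness_of_isRCLikeNormedField]
    exact IsManifold.of_le (n := ∞) ((WithTop.coe_le_coe.2 (le_top : (3 : ℕ∞) ≤ ⊤)))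
  have hle : minSmoothness ℝ 2 ≤ (∞ : WithTop ℕ∞) := by
    rw [minSmoothness_of_isRCLikeNormedField]
    exact (WithTop.coe_le_coe.2 (le_top : (2 : ℕ∞) ≤ ⊤))
  exact VectorField.leibniz_identity_mlieBracket_apply ((hX.contMDiffAt hU hx).of_le hle)
    ((hY.contMDiffAt hU hx).of_le hle) ((hZ.contMDiffAt hU hx).of_le hle)

/-! #### The metric -/

theorem LorentzMetric.smoothFn (g : LorentzMetric M) (hX : SmoothField U X)
    (hY : SmoothField U Y) : SmoothFn U (fun y => g.val y (X y) (Y y)) := by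
  intro y hy
  have h := ContMDiffWithinAt.clm_bundle_apply₂
    (F₁ := EuclideanSpace ℝ (Fin 3)) (F₂ := EuclideanSpace ℝ (Fin 3)) (F₃ := ℝ)
    (E₁ := fun x : M => TangentSpace (𝓡 3) x) (E₂ := fun x : M => TangentSpace (𝓡 3) x)
    (E₃ := fun _ : M => ℝ) (b := fun x : M => x)
    (g.smooth y).contMDiffWithinAt (hX y hy) (hY y hy)
  simpa using Bundle.contMDiffWithinAt_section.1 h

end SmoothFields

/-! ### The Levi-Civita connection on smooth fields. -/

section Connection

variable {M : Type*} [TopologicalSpace M] [ChartedSpace (EuclideanSpace ℝ (Fin 3)) M]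
  [IsManifold (𝓡 3) ∞ M] {g : LorentzMetric M} {U : Set M} {e : Fin 3 → VField M}
  {x : M} {f f' : M → ℝ} {X Y Z X' Y' : VField M}

/-- A family with Gram matrix `η` spans the tangent space. -/
theorem LorentzMetric.exists_coord (g : LorentzMetric M) {b : Fin 3 → TangentSpace (𝓡 3) x}
    (hb : ∀ a c, g.val x (b a) (b c) = eta a c) (v : TangentSpace (𝓡 3) x) :
    ∃ c : Fin 3 → ℝ, v = ∑ a, c a • b a := by
  have key : ∀ c : Fin 3 → ℝ, (∀ d, g.val x (∑ a, c a • b a) (b d) = 0) → ∀ a, c a = 0 := by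
    intro c hc
    have h0 := hc 0
    have h1 := hc 1
    have h2 := hc 2
    simp [Fin.sum_univ_three, hb, eta] at h0 h1 h2
    intro a
    fin_cases a <;> simp [h0, h1, h2]
  have hli : LinearIndependent ℝ b := by
    rw [Fintype.linearIndependent_iff]
    intro c hc
    exact key c (fun d => by rw [hc]; simp)
  have hcard : Fintype.card (Fin 3) = Module.finrank ℝ (TangentSpace (𝓡 3) x) := by
    change _ = Module.finrank ℝ (EuclideanSpace ℝ (Fin 3))
    simp
  have hv := (basisOfLinearIndependentOfCardEqFinrank hli hcard).sum_repr v
  simp only [coe_basisOfLinearIndependentOfCardEqFinrank] at hv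
  exact ⟨_, hv.symm⟩

theorem LorentzMetric.expand (g : LorentzMetric M) {b : Fin 3 → TangentSpace (𝓡 3) x}
    (hb : ∀ a c, g.val x (b a) (b c) = eta a c) (v : TangentSpace (𝓡 3) x) :
    v = ∑ a, (∑ c, etaInv a c * g.val x v (b c)) • b a := by
  obtain ⟨c, rfl⟩ := g.exists_coord hb v
  refine Finset.sum_congr rfl fun a _ => ?_
  congr 1
  fin_cases a <;> simp [Fin.sum_univ_three, hb, eta, etaInv]
  ring

theorem LorentzMetric.ext (g : LorentzMetric M) {b : Fin 3 → TangentSpace (𝓡 3) x}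
    (hb : ∀ a c, g.val x (b a) (b c) = eta a c) {v w : TangentSpace (𝓡 3) x}
    (h : ∀ a, g.val x v (b a) = g.val x w (b a)) : v = w := by
  rw [g.expand hb v, g.expand hb w]
  simp [h]

namespace IsMovingFrame

theorem smoothField (hF : IsMovingFrame g U e) (a : Fin 3) : SmoothField U (e a) := hF.smooth a

theorem mono (hF : IsMovingFrame g U e) {V : Set M} (hV : IsOpen V) (h : V ⊆ U) :
    IsMovingFrame g V e :=
  ⟨hV, fun a => (hF.smooth a).mono h, fun x hx => hF.orthonormal x (h hx)⟩

/-- The function X(f) is recovered from brackets: [X, f e₁] - f [X, e₁] = X(f) e₁. Pairing with e₁,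
where g(e₁, e₁) = 1/2, explains the factor 2. -/
theorem dirDeriv (hF : IsMovingFrame g U e) (hX : SmoothField U X) (hf : SmoothFn U f) :
    SmoothFn U (dirDeriv X f) := by
  have h1 := g.smoothFn (SmoothField.bracket hF.isOpen hX ((hF.smoothField 1).smul hf))
    (hF.smoothField 1)
  have h2 := hf.mul (g.smoothFn (SmoothField.bracket hF.isOpen hX (hF.smoothField 1))
    (hF.smoothField 1))
  refine ((smoothFn_const 2).mul (h1.sub h2)).congr fun y hy => ?_
  rw [bracket_smul_right hF.isOpen hy hf (hF.smoothField 1)]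
  simp [hF.orthonormal y hy, eta]
  ring

/-- Compare the Jacobi identity for X, Y, f e₁ with f times the one for X, Y, e₁. What remains is
the claim multiplied by e₁, and pairing with e₁ removes that factor. -/
theorem dirDeriv_bracket (hF : IsMovingFrame g U e) (hx : x ∈ U) (hX : SmoothField U X)
    (hY : SmoothField U Y) (hf : SmoothFn U f) :
    CurvHom.dirDeriv (bracket X Y) f x
      = CurvHom.dirDeriv X (CurvHom.dirDeriv Y f) x
        - CurvHom.dirDeriv Y (CurvHom.dirDeriv X f) x := by
  have hU := hF.isOpen
  have hZ := hF.smoothField 1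
  have key : ∀ {V W : VField M}, SmoothField U V → SmoothField U W →
      bracket V (bracket W (f • e 1)) x
        = CurvHom.dirDeriv V (CurvHom.dirDeriv W f) x • e 1 x
          + CurvHom.dirDeriv W f x • bracket V (e 1) x
          + (CurvHom.dirDeriv V f x • bracket W (e 1) x
            + f x • bracket V (bracket W (e 1)) x) := by
    intro V W hV hW
    have h1 : ∀ y ∈ U, bracket W (f • e 1) y
        = (CurvHom.dirDeriv W f • e 1 + f • bracket W (e 1)) y := fun y hy =>
      bracket_smul_right hU hy hf hZ W
    have hWZ := SmoothField.bracket hU hW hZ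
    rw [bracket_congr hU hx (fun _ _ => rfl) h1,
      bracket_add_right hU hx (hZ.smul (hF.dirDeriv hW hf)) (hWZ.smul hf),
      bracket_smul_right hU hx (hF.dirDeriv hW hf) hZ, bracket_smul_right hU hx hf hWZ]
  have hJ := bracket_jacobi hU hx hX hY (hZ.smul hf)
  have hJ' := bracket_jacobi hU hx hX hY hZ
  rw [key hX hY, key hY hX, bracket_smul_right hU hx hf hZ, hJ'] at hJ
  have h0 := congrArg (fun v => g.val x v (e 1 x)) hJ
  simp [hF.orthonormal x hx, eta] at h0
  linarith

theorem smoothFn_koszul (hF : IsMovingFrame g U e) (hX : SmoothField U X) (hY : SmoothField U Y)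
    (hZ : SmoothField U Z) : SmoothFn U (koszul g X Y Z) := by
  have hU := hF.isOpen
  exact (smoothFn_const (1 / 2)).mul ((((((hF.dirDeriv hX (g.smoothFn hY hZ)).add
    (hF.dirDeriv hY (g.smoothFn hX hZ))).sub (hF.dirDeriv hZ (g.smoothFn hX hY))).add
    (g.smoothFn (hX.bracket hU hY) hZ)).sub (g.smoothFn (hX.bracket hU hZ) hY)).sub
    (g.smoothFn (hY.bracket hU hZ) hX))

theorem nabla_spec (hF : IsMovingFrame g U e) (hx : x ∈ U) (hX : SmoothField U X)
    (hY : SmoothField U Y) (hZ : SmoothField U Z) :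
    g.val x (leviCivita g X Y x) (Z x) = koszul g X Y Z x :=
  leviCivita_spec g X Y x (hX.vdiff hF.isOpen hx) (hY.vdiff hF.isOpen hx) Z
    (hZ.vdiff hF.isOpen hx)

/-- The frame coefficients of the covariant derivative are Koszul expressions, which are smooth. -/
theorem nabla (hF : IsMovingFrame g U e) (hX : SmoothField U X) (hY : SmoothField U Y) :
    SmoothField U (leviCivita g X Y) := by
  have h : SmoothField U (∑ a, (fun y => ∑ c, etaInv a c * koszul g X Y (e c) y) • e a) :=
    SmoothField.sum fun a _ => (hF.smoothField a).smul <| SmoothFn.sum fun c _ =>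
      (smoothFn_const _).mul (hF.smoothFn_koszul hX hY (hF.smoothField c))
  refine h.congr fun y hy => ?_
  rw [g.expand (hF.orthonormal y hy) (leviCivita g X Y y)]
  simp [hF.nabla_spec hy hX hY (hF.smoothField _)]

theorem ext (hF : IsMovingFrame g U e) (hx : x ∈ U) {v w : TangentSpace (𝓡 3) x}
    (h : ∀ Z, SmoothField U Z → g.val x v (Z x) = g.val x w (Z x)) : v = w :=
  g.ext (hF.orthonormal x hx) fun a => h (e a) (hF.smoothField a)

theorem nabla_congr (hF : IsMovingFrame g U e) (hx : x ∈ U) (hX : SmoothField U X)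
    (hY : SmoothField U Y) (hXX : ∀ y ∈ U, X' y = X y) (hYY : ∀ y ∈ U, Y' y = Y y) :
    leviCivita g X' Y' x = leviCivita g X Y x := by
  have hU := hF.isOpen
  refine hF.ext hx fun Z hZ => ?_
  rw [hF.nabla_spec hx (hX.congr hXX) (hY.congr hYY) hZ, hF.nabla_spec hx hX hY hZ]
  have hZZ : ∀ y ∈ U, Z y = Z y := fun _ _ => rfl
  have e1 : CurvHom.dirDeriv X' (fun y => g.val y (Y' y) (Z y)) x
      = CurvHom.dirDeriv X (fun y => g.val y (Y y) (Z y)) x := by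
    rw [dirDeriv_congr_left (hXX x hx), dirDeriv_congr hU hx (fun y hy => by rw [hYY y hy])]
  have e2 : CurvHom.dirDeriv Y' (fun y => g.val y (X' y) (Z y)) x
      = CurvHom.dirDeriv Y (fun y => g.val y (X y) (Z y)) x := by
    rw [dirDeriv_congr_left (hYY x hx), dirDeriv_congr hU hx (fun y hy => by rw [hXX y hy])]
  have e3 : CurvHom.dirDeriv Z (fun y => g.val y (X' y) (Y' y)) x
      = CurvHom.dirDeriv Z (fun y => g.val y (X y) (Y y)) x :=
    dirDeriv_congr hU hx (fun y hy => by rw [hXX y hy, hYY y hy]) _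
  have e4 : VectorField.mlieBracket (𝓡 3) X' Y' x = VectorField.mlieBracket (𝓡 3) X Y x :=
    bracket_congr hU hx hXX hYY
  have e5 : VectorField.mlieBracket (𝓡 3) X' Z x = VectorField.mlieBracket (𝓡 3) X Z x :=
    bracket_congr hU hx hXX hZZ
  have e6 : VectorField.mlieBracket (𝓡 3) Y' Z x = VectorField.mlieBracket (𝓡 3) Y Z x :=
    bracket_congr hU hx hYY hZZ
  simp only [koszul, e1, e2, e3, e4, e5, e6, hXX x hx, hYY x hx]

theorem nabla_add_right (hF : IsMovingFrame g U e) (hx : x ∈ U) (hX : SmoothField U X)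
    (hY : SmoothField U Y) (hY' : SmoothField U Y') :
    leviCivita g X (Y + Y') x = leviCivita g X Y x + leviCivita g X Y' x := by
  have hU := hF.isOpen
  refine hF.ext hx fun Z hZ => ?_
  simp only [map_add, add_apply]
  rw [hF.nabla_spec hx hX (hY.add hY') hZ, hF.nabla_spec hx hX hY hZ, hF.nabla_spec hx hX hY' hZ]
  have h1 := dirDeriv_add hU hx (g.smoothFn hY hZ) (g.smoothFn hY' hZ) X
  have h2 := dirDeriv_add hU hx (g.smoothFn hX hY) (g.smoothFn hX hY') Z
  have h3 := bracket_add_right hU hx hY hY' X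
  have h4 := bracket_add_left hU hx hY hY' Z
  simp only [bracket] at h3 h4
  simp only [koszul, Pi.add_apply, map_add, add_apply, h1, h2, h3, h4,
    dirDeriv_add_left]
  ring

theorem nabla_add_left (hF : IsMovingFrame g U e) (hx : x ∈ U) (hX : SmoothField U X)
    (hX' : SmoothField U X') (hY : SmoothField U Y) :
    leviCivita g (X + X') Y x = leviCivita g X Y x + leviCivita g X' Y x := by
  have hU := hF.isOpen
  refine hF.ext hx fun Z hZ => ?_
  simp only [map_add, add_apply]
  rw [hF.nabla_spec hx (hX.add hX') hY hZ, hF.nabla_spec hx hX hY hZ, hF.nabla_spec hx hX' hY hZ]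
  have h1 := dirDeriv_add hU hx (g.smoothFn hX hZ) (g.smoothFn hX' hZ) Y
  have h2 := dirDeriv_add hU hx (g.smoothFn hX hY) (g.smoothFn hX' hY) Z
  have h3 := bracket_add_left hU hx hX hX' Y
  have h4 := bracket_add_left hU hx hX hX' Z
  simp only [bracket] at h3 h4
  simp only [koszul, Pi.add_apply, map_add, add_apply, h1, h2, h3, h4,
    dirDeriv_add_left]
  ring

theorem nabla_smul_right (hF : IsMovingFrame g U e) (hx : x ∈ U) (hX : SmoothField U X)
    (hf : SmoothFn U f) (hY : SmoothField U Y) :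
    leviCivita g X (f • Y) x = f x • leviCivita g X Y x + CurvHom.dirDeriv X f x • Y x := by
  have hU := hF.isOpen
  refine hF.ext hx fun Z hZ => ?_
  simp only [map_add, map_smul, add_apply, smul_apply, smul_eq_mul]
  rw [hF.nabla_spec hx hX (hY.smul hf) hZ, hF.nabla_spec hx hX hY hZ]
  have h1 := dirDeriv_mul hU hx hf (g.smoothFn hY hZ) X
  have h2 := dirDeriv_mul hU hx hf (g.smoothFn hX hY) Z
  have h3 := bracket_smul_right hU hx hf hY X
  have h4 := bracket_smul_left hU hx hf hY Z
  simp only [bracket] at h3 h4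
  simp only [koszul, Pi.smul_apply', map_add, map_smul, add_apply,
    smul_apply, smul_eq_mul, h1, h2, h3, h4, dirDeriv_smul_left,
    map_neg, neg_smul, neg_apply]
  rw [g.symm x (Y x) (X x)]
  ring

theorem nabla_smul_left (hF : IsMovingFrame g U e) (hx : x ∈ U) (hX : SmoothField U X)
    (hf : SmoothFn U f) (hY : SmoothField U Y) :
    leviCivita g (f • X) Y x = f x • leviCivita g X Y x := by
  have hU := hF.isOpen
  refine hF.ext hx fun Z hZ => ?_
  simp only [map_smul, smul_apply, smul_eq_mul]
  rw [hF.nabla_spec hx (hX.smul hf) hY hZ, hF.nabla_spec hx hX hY hZ]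
  have h1 := dirDeriv_mul hU hx hf (g.smoothFn hX hZ) Y
  have h2 := dirDeriv_mul hU hx hf (g.smoothFn hX hY) Z
  have h3 := bracket_smul_left hU hx hf hX Y
  have h4 := bracket_smul_left hU hx hf hX Z
  simp only [bracket] at h3 h4
  simp only [koszul, Pi.smul_apply', map_add, map_smul, add_apply,
    smul_apply, smul_eq_mul, h1, h2, h3, h4, dirDeriv_smul_left,
    map_neg, neg_smul, neg_apply]
  ring

theorem nabla_torsion (hF : IsMovingFrame g U e) (hx : x ∈ U) (hX : SmoothField U X)
    (hY : SmoothField U Y) :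
    leviCivita g X Y x - leviCivita g Y X x = bracket X Y x := by
  refine hF.ext hx fun Z hZ => ?_
  simp only [map_sub, sub_apply]
  rw [hF.nabla_spec hx hX hY hZ, hF.nabla_spec hx hY hX hZ]
  have h1 := bracket_swap X Y x
  simp only [bracket] at h1
  have h2 : (fun y => g.val y (X y) (Y y)) = fun y => g.val y (Y y) (X y) :=
    funext fun y => g.symm _ _ _
  simp only [koszul, bracket, h1, h2, map_neg, neg_apply]
  ring

theorem nabla_metric (hF : IsMovingFrame g U e) (hx : x ∈ U) (hX : SmoothField U X)
    (hY : SmoothField U Y) (hZ : SmoothField U Z) :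
    CurvHom.dirDeriv X (fun y => g.val y (Y y) (Z y)) x
      = g.val x (leviCivita g X Y x) (Z x) + g.val x (Y x) (leviCivita g X Z x) := by
  rw [g.symm x (Y x), hF.nabla_spec hx hX hY hZ, hF.nabla_spec hx hX hZ hY]
  have h1 := bracket_swap Z Y x
  simp only [bracket] at h1
  have h2 : (fun y => g.val y (Z y) (Y y)) = fun y => g.val y (Y y) (Z y) :=
    funext fun y => g.symm _ _ _
  simp only [koszul, h1, h2, map_neg, neg_apply]
  ring

end IsMovingFrame

end Connection

/-! ### Tensoriality of the curvature operator and of covariant derivatives. -/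

section Tensorial

variable {M : Type*} [TopologicalSpace M] [ChartedSpace (EuclideanSpace ℝ (Fin 3)) M]

theorem update_castSucc {n : ℕ} (W : Fin (n + 1) → VField M) (k : Fin n) (X : VField M) :
    (fun i : Fin n => Function.update W k.castSucc X i.castSucc)
      = Function.update (fun i : Fin n => W i.castSucc) k X := by
  funext i
  by_cases h : i = k
  · subst h; simp
  · simp [h]

theorem update_last_castSucc {n : ℕ} (W : Fin (n + 1) → VField M) (X : VField M) (i : Fin n) :
    Function.update W (Fin.last n) X i.castSucc = W i.castSucc := by
  simp [Fin.castSucc_ne_last]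

variable [IsManifold (𝓡 3) ∞ M] {g : LorentzMetric M} {U : Set M} {e : Fin 3 → VField M}
  {x : M} {f f' : M → ℝ} {X Y Z X' Y' Z' : VField M}

namespace IsMovingFrame

theorem curvOp (hF : IsMovingFrame g U e) (hX : SmoothField U X) (hY : SmoothField U Y)
    (hZ : SmoothField U Z) : SmoothField U (curvOp g X Y Z) :=
  ((hF.nabla hX (hF.nabla hY hZ)).sub (hF.nabla hY (hF.nabla hX hZ))).sub
    (hF.nabla (hX.bracket hF.isOpen hY) hZ)

theorem curvOp_swap (hF : IsMovingFrame g U e) (hx : x ∈ U) (hX : SmoothField U X)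
    (hY : SmoothField U Y) (hZ : SmoothField U Z) :
    CurvHom.curvOp g X Y Z x = -CurvHom.curvOp g Y X Z x := by
  have hYX := hY.bracket hF.isOpen hX
  have h : leviCivita g (bracket X Y) Z x = -leviCivita g (bracket Y X) Z x := by
    have hf : SmoothFn U (fun _ : M => (-1 : ℝ)) := smoothFn_const _
    rw [hF.nabla_congr hx (hYX.smul hf) hZ (fun y _ => by rw [bracket_swap]; simp)
      (fun _ _ => rfl), hF.nabla_smul_left hx hYX hf hZ]
    simp
  simp only [bracket] at h
  simp only [CurvHom.curvOp, h]
  abel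

theorem curvOp_add_left (hF : IsMovingFrame g U e) (hx : x ∈ U) (hX : SmoothField U X)
    (hX' : SmoothField U X') (hY : SmoothField U Y) (hZ : SmoothField U Z) :
    CurvHom.curvOp g (X + X') Y Z x
      = CurvHom.curvOp g X Y Z x + CurvHom.curvOp g X' Y Z x := by
  have hU := hF.isOpen
  have h1 := hF.nabla_add_left hx hX hX' (hF.nabla hY hZ)
  have h2 : leviCivita g Y (leviCivita g (X + X') Z) x
      = leviCivita g Y (leviCivita g X Z) x + leviCivita g Y (leviCivita g X' Z) x := by
    rw [← hF.nabla_add_right hx hY (hF.nabla hX hZ) (hF.nabla hX' hZ)]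
    exact hF.nabla_congr hx hY ((hF.nabla hX hZ).add (hF.nabla hX' hZ)) (fun _ _ => rfl)
      (fun y hy => hF.nabla_add_left hy hX hX' hZ)
  have h3 : leviCivita g (bracket (X + X') Y) Z x
      = leviCivita g (bracket X Y) Z x + leviCivita g (bracket X' Y) Z x := by
    rw [← hF.nabla_add_left hx (hX.bracket hU hY) (hX'.bracket hU hY) hZ]
    exact hF.nabla_congr hx ((hX.bracket hU hY).add (hX'.bracket hU hY)) hZ
      (fun y hy => bracket_add_left hU hy hX hX' Y) (fun _ _ => rfl)
  simp only [bracket] at h3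
  simp only [CurvHom.curvOp, h1, h2, h3]
  abel

theorem curvOp_smul_left (hF : IsMovingFrame g U e) (hx : x ∈ U) (hf : SmoothFn U f)
    (hX : SmoothField U X) (hY : SmoothField U Y) (hZ : SmoothField U Z) :
    CurvHom.curvOp g (f • X) Y Z x = f x • CurvHom.curvOp g X Y Z x := by
  have hU := hF.isOpen
  have hXZ := hF.nabla hX hZ
  have hXY := hX.bracket hU hY
  have h1 := hF.nabla_smul_left hx hX hf (hF.nabla hY hZ)
  have h2 : leviCivita g Y (leviCivita g (f • X) Z) x
      = f x • leviCivita g Y (leviCivita g X Z) x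
        + CurvHom.dirDeriv Y f x • leviCivita g X Z x := by
    rw [← hF.nabla_smul_right hx hY hf hXZ]
    exact hF.nabla_congr hx hY (hXZ.smul hf) (fun _ _ => rfl)
      (fun y hy => hF.nabla_smul_left hy hX hf hZ)
  have h3 : leviCivita g (bracket (f • X) Y) Z x
      = -CurvHom.dirDeriv Y f x • leviCivita g X Z x
        + f x • leviCivita g (bracket X Y) Z x := by
    have hd := (hF.dirDeriv hY hf).neg
    have := hF.nabla_smul_left hx hX hd hZ
    rw [← this, ← hF.nabla_smul_left hx hXY hf hZ,
      ← hF.nabla_add_left hx (hX.smul hd) (hXY.smul hf) hZ]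
    exact hF.nabla_congr hx ((hX.smul hd).add (hXY.smul hf)) hZ
      (fun y hy => bracket_smul_left hU hy hf hX Y) (fun _ _ => rfl)
  simp only [bracket] at h3
  simp only [CurvHom.curvOp, h1, h2, h3, smul_sub, neg_smul]
  abel

theorem curvOp_add_right (hF : IsMovingFrame g U e) (hx : x ∈ U) (hX : SmoothField U X)
    (hY : SmoothField U Y) (hZ : SmoothField U Z) (hZ' : SmoothField U Z') :
    CurvHom.curvOp g X Y (Z + Z') x
      = CurvHom.curvOp g X Y Z x + CurvHom.curvOp g X Y Z' x := by
  have key : ∀ {V W : VField M}, SmoothField U V → SmoothField U W →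
      leviCivita g V (leviCivita g W (Z + Z')) x
        = leviCivita g V (leviCivita g W Z) x + leviCivita g V (leviCivita g W Z') x := by
    intro V W hV hW
    rw [← hF.nabla_add_right hx hV (hF.nabla hW hZ) (hF.nabla hW hZ')]
    exact hF.nabla_congr hx hV ((hF.nabla hW hZ).add (hF.nabla hW hZ')) (fun _ _ => rfl)
      (fun y hy => hF.nabla_add_right hy hW hZ hZ')
  have h3 := hF.nabla_add_right hx (hX.bracket hF.isOpen hY) hZ hZ'
  simp only [bracket] at h3
  simp only [CurvHom.curvOp, key hX hY, key hY hX, h3]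
  abel

/-- The mixed first-order terms X(f)∇_Y Z + Y(f)∇_X Z are symmetric in X and Y and cancel. The
second derivatives of f cancel against [X, Y](f), by `dirDeriv_bracket`. -/
theorem curvOp_smul_right (hF : IsMovingFrame g U e) (hx : x ∈ U) (hX : SmoothField U X)
    (hY : SmoothField U Y) (hf : SmoothFn U f) (hZ : SmoothField U Z) :
    CurvHom.curvOp g X Y (f • Z) x = f x • CurvHom.curvOp g X Y Z x := by
  have key : ∀ {V W : VField M}, SmoothField U V → SmoothField U W →
      leviCivita g V (leviCivita g W (f • Z)) x
        = (f x • leviCivita g V (leviCivita g W Z) x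
          + CurvHom.dirDeriv V f x • leviCivita g W Z x)
          + (CurvHom.dirDeriv W f x • leviCivita g V Z x
          + CurvHom.dirDeriv V (CurvHom.dirDeriv W f) x • Z x) := by
    intro V W hV hW
    have hWZ := hF.nabla hW hZ
    have hWf := hF.dirDeriv hW hf
    rw [← hF.nabla_smul_right hx hV hf hWZ, ← hF.nabla_smul_right hx hV hWf hZ,
      ← hF.nabla_add_right hx hV (hWZ.smul hf) (hZ.smul hWf)]
    exact hF.nabla_congr hx hV ((hWZ.smul hf).add (hZ.smul hWf)) (fun _ _ => rfl)
      (fun y hy => hF.nabla_smul_right hy hW hf hZ)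
  have h3 := hF.nabla_smul_right hx (hX.bracket hF.isOpen hY) hf hZ
  rw [hF.dirDeriv_bracket hx hX hY hf] at h3
  simp only [bracket] at h3
  simp only [CurvHom.curvOp, key hX hY, key hY hX, h3, smul_sub, sub_smul]
  abel

end IsMovingFrame

/-- An operation on vector fields which is smooth and multilinear over smooth functions on `U`. -/
structure IsTensorial (U : Set M) {n : ℕ} (T : (Fin n → VField M) → M → ℝ) : Prop where
  smooth : ∀ {W}, (∀ i, SmoothField U (W i)) → SmoothFn U (T W)
  add : ∀ {W}, (∀ i, SmoothField U (W i)) → ∀ i {X Y}, SmoothField U X → SmoothField U Y →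
    ∀ {x}, x ∈ U → T (Function.update W i (X + Y)) x
      = T (Function.update W i X) x + T (Function.update W i Y) x
  smul : ∀ {W}, (∀ i, SmoothField U (W i)) → ∀ i {f X}, SmoothFn U f → SmoothField U X →
    ∀ {x}, x ∈ U → T (Function.update W i (f • X)) x = f x * T (Function.update W i X) x

theorem smoothField_update {n : ℕ} {W : Fin n → VField M} (hW : ∀ i, SmoothField U (W i))
    (i : Fin n) (hX : SmoothField U X) : ∀ k, SmoothField U (Function.update W i X k) := by
  intro k
  by_cases h : k = i
  · subst h; simpa using hX
  · simpa [h] using hW k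

namespace IsTensorial

variable {n : ℕ} {T : (Fin n → VField M) → M → ℝ} {W : Fin n → VField M}

/-- Locality comes from linearity over functions that are smooth on `U` only. The indicator function
of `U` is such a function, and multiplying by it makes the two fields equal everywhere without
changing values on `U`. -/
theorem congr (hT : IsTensorial U T) (hW : ∀ i, SmoothField U (W i)) (i : Fin n)
    (hX : SmoothField U X) (h : ∀ y ∈ U, X' y = X y) (hx : x ∈ U) :
    T (Function.update W i X') x = T (Function.update W i X) x := by
  classical
  set φ : M → ℝ := fun y => if y ∈ U then 1 else 0 with hφ
  have hφs : SmoothFn U φ := (smoothFn_const 1).congr fun y hy => by simp [hφ, hy]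
  have h1 := hT.smul hW i hφs hX hx
  have h2 := hT.smul hW i hφs (hX.congr h) hx
  have h3 : φ • X' = φ • X := by
    funext y
    by_cases hy : y ∈ U <;> simp [hφ, hy, h]
  rw [h3, h1] at h2
  simpa [hφ, hx] using h2.symm

theorem sum (hT : IsTensorial U T) (hW : ∀ i, SmoothField U (W i)) (i : Fin n) {ι : Type*}
    (s : Finset ι) {F : ι → VField M} (h : ∀ k ∈ s, SmoothField U (F k)) (hx : x ∈ U) :
    T (Function.update W i (∑ k ∈ s, F k)) x = ∑ k ∈ s, T (Function.update W i (F k)) x := by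
  classical
  induction s using Finset.induction_on with
  | empty =>
    have := hT.smul hW i (smoothFn_const 0) (smoothField_zero (M := M)) hx
    simp only [zero_mul] at this
    simp only [Finset.sum_empty]
    refine Eq.trans ?_ this
    congr 2
    ext y
    simp
  | insert k s hk ih =>
    rw [Finset.sum_insert hk, Finset.sum_insert hk, hT.add hW i (h k (by simp))
      (SmoothField.sum fun j hj => h j (by simp [hj])) hx, ih fun j hj => h j (by simp [hj])]

end IsTensorial

/-- The covariant derivative of an operation on vector fields. -/
def covDeriv (g : LorentzMetric M) {n : ℕ} (T : (Fin n → VField M) → M → ℝ)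
    (W : Fin (n + 1) → VField M) (x : M) : ℝ :=
  dirDeriv (W (Fin.last n)) (T (fun i => W i.castSucc)) x
    - ∑ i, T (Function.update (fun i => W i.castSucc) i
        (leviCivita g (W (Fin.last n)) (W i.castSucc))) x

/-- Linearity in the differentiation slot is inherited from the directional derivative and from ∇.
In any other slot, the derivative of the coefficient produced by differentiating `T` is cancelled by
the Leibniz term of ∇ in that slot. -/
theorem IsTensorial.covDeriv (hF : IsMovingFrame g U e) {n : ℕ}
    {T : (Fin n → VField M) → M → ℝ} (hT : IsTensorial U T) :
    IsTensorial U (covDeriv g T) where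
  smooth {W} hW := by
    have h := hF.dirDeriv (hW (Fin.last n)) (hT.smooth fun i : Fin n => hW i.castSucc)
    exact h.sub (SmoothFn.sum fun i _ => hT.smooth
      (smoothField_update (fun i => hW _) i (hF.nabla (hW _) (hW _))))
  add {W} hW i {X Y} hX hY x hx := by
    have hw : ∀ k : Fin n, SmoothField U (W k.castSucc) := fun k => hW _
    refine Fin.lastCases ?_ (fun k => ?_) i
    · simp only [CurvHom.covDeriv, Function.update_self, update_last_castSucc, dirDeriv_add_left]
      have : ∀ i : Fin n, T (Function.update (fun i => W i.castSucc) i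
            (leviCivita g (X + Y) (W i.castSucc))) x
          = T (Function.update (fun i => W i.castSucc) i (leviCivita g X (W i.castSucc))) x
            + T (Function.update (fun i => W i.castSucc) i (leviCivita g Y (W i.castSucc))) x := by
        intro i
        rw [← hT.add hw i (hF.nabla hX (hw i)) (hF.nabla hY (hw i)) hx]
        exact hT.congr hw i ((hF.nabla hX (hw i)).add (hF.nabla hY (hw i)))
          (fun y hy => hF.nabla_add_left hy hX hY (hw i)) hx
      simp only [this, Finset.sum_add_distrib]
      ring
    · have hl : ∀ V, Function.update W k.castSucc V (Fin.last n) = W (Fin.last n) := fun V => by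
        simp [(Fin.castSucc_ne_last k).symm]
      simp only [CurvHom.covDeriv, hl, update_castSucc]
      set L := W (Fin.last n) with hL
      have hLs : SmoothField U L := hW _
      set w : Fin n → VField M := fun i => W i.castSucc with hw'
      have h1 : dirDeriv L (T (Function.update w k (X + Y))) x
          = dirDeriv L (T (Function.update w k X)) x
            + dirDeriv L (T (Function.update w k Y)) x := by
        rw [← dirDeriv_add hF.isOpen hx (hT.smooth (smoothField_update hw k hX))
          (hT.smooth (smoothField_update hw k hY))]
        exact dirDeriv_congr hF.isOpen hx (fun y hy => hT.add hw k hX hY hy) L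
      have h2 : ∀ i : Fin n,
          T (Function.update (Function.update w k (X + Y)) i
              (leviCivita g L (Function.update W k.castSucc (X + Y) i.castSucc))) x
          = T (Function.update (Function.update w k X) i
              (leviCivita g L (Function.update W k.castSucc X i.castSucc))) x
            + T (Function.update (Function.update w k Y) i
              (leviCivita g L (Function.update W k.castSucc Y i.castSucc))) x := by
        intro i
        by_cases h : i = k
        · subst h
          simp only [Function.update_self, Function.update_idem]
          rw [← hT.add hw i (hF.nabla hLs hX) (hF.nabla hLs hY) hx]
          exact hT.congr hw i ((hF.nabla hLs hX).add (hF.nabla hLs hY))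
            (fun y hy => hF.nabla_add_right hy hLs hX hY) hx
        · have hne : i.castSucc ≠ k.castSucc := fun hh => h (Fin.castSucc_injective _ hh)
          simp only [Function.update_of_ne hne, Function.update_comm (Ne.symm h)]
          exact hT.add (smoothField_update hw i (hF.nabla hLs (hw i))) k hX hY hx
      rw [h1, Finset.sum_congr rfl fun i _ => h2 i, Finset.sum_add_distrib]
      ring
  smul {W} hW i {f X} hf hX x hx := by
    have hw : ∀ k : Fin n, SmoothField U (W k.castSucc) := fun k => hW _
    refine Fin.lastCases ?_ (fun k => ?_) i
    · simp only [CurvHom.covDeriv, Function.update_self, update_last_castSucc, dirDeriv_smul_left]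
      have : ∀ i : Fin n, T (Function.update (fun i => W i.castSucc) i
            (leviCivita g (f • X) (W i.castSucc))) x
          = f x * T (Function.update (fun i => W i.castSucc) i
              (leviCivita g X (W i.castSucc))) x := by
        intro i
        rw [← hT.smul hw i hf (hF.nabla hX (hw i)) hx]
        exact hT.congr hw i ((hF.nabla hX (hw i)).smul hf)
          (fun y hy => hF.nabla_smul_left hy hX hf (hw i)) hx
      simp only [this, ← Finset.mul_sum]
      ring
    · have hl : ∀ V, Function.update W k.castSucc V (Fin.last n) = W (Fin.last n) := fun V => by
        simp [(Fin.castSucc_ne_last k).symm]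
      simp only [CurvHom.covDeriv, hl, update_castSucc]
      set L := W (Fin.last n) with hL
      have hLs : SmoothField U L := hW _
      set w : Fin n → VField M := fun i => W i.castSucc with hw'
      have h1 : dirDeriv L (T (Function.update w k (f • X))) x
          = f x * dirDeriv L (T (Function.update w k X)) x
            + T (Function.update w k X) x * dirDeriv L f x := by
        rw [← dirDeriv_mul hF.isOpen hx hf (hT.smooth (smoothField_update hw k hX))]
        exact dirDeriv_congr hF.isOpen hx (fun y hy => hT.smul hw k hf hX hy) L
      -- Only the correction in the slot `k` itself differentiates `f`. The `if` records this
      -- Leibniz term.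
      have h2 : ∀ i : Fin n,
          T (Function.update (Function.update w k (f • X)) i
              (leviCivita g L (Function.update W k.castSucc (f • X) i.castSucc))) x
          = f x * T (Function.update (Function.update w k X) i
              (leviCivita g L (Function.update W k.castSucc X i.castSucc))) x
            + if i = k then T (Function.update w k X) x * dirDeriv L f x else 0 := by
        intro i
        by_cases h : i = k
        · subst h
          simp only [Function.update_self, Function.update_idem, if_true]
          rw [mul_comm (T _ x) (dirDeriv L f x), ← hT.smul hw i hf (hF.nabla hLs hX) hx,
            ← hT.smul hw i (hF.dirDeriv hLs hf) hX hx,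
            ← hT.add hw i ((hF.nabla hLs hX).smul hf) (hX.smul (hF.dirDeriv hLs hf)) hx]
          exact hT.congr hw i (((hF.nabla hLs hX).smul hf).add (hX.smul (hF.dirDeriv hLs hf)))
            (fun y hy => hF.nabla_smul_right hy hLs hf hX) hx
        · have hne : i.castSucc ≠ k.castSucc := fun hh => h (Fin.castSucc_injective _ hh)
          simp only [Function.update_of_ne hne, Function.update_comm (Ne.symm h), if_neg h, add_zero]
          exact hT.smul (smoothField_update hw i (hF.nabla hLs (hw i))) k hf hX hx
      rw [h1, Finset.sum_congr rfl fun i _ => h2 i, Finset.sum_add_distrib, ← Finset.mul_sum]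
      simp
      ring

end Tensorial

/-! ### Pointwise dependence on the arguments and change of frame. -/

section FrameChange

variable {M : Type*} [TopologicalSpace M] [ChartedSpace (EuclideanSpace ℝ (Fin 3)) M]
  [IsManifold (𝓡 3) ∞ M] {g : LorentzMetric M} {U : Set M} {e : Fin 3 → VField M}
  {x : M} {f f' : M → ℝ} {X Y Z X' Y' Z' : VField M}
  {n : ℕ} {T : (Fin n → VField M) → M → ℝ} {W W' : Fin n → VField M}

namespace IsTensorial

theorem update_frame (hF : IsMovingFrame g U e) (hT : IsTensorial U T)
    (hW : ∀ i, SmoothField U (W i)) (i : Fin n) (hX : SmoothField U X) (hx : x ∈ U) :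
    T (Function.update W i X) x
      = ∑ a, (∑ c, etaInv a c * g.val x (X x) (e c x)) * T (Function.update W i (e a)) x := by
  have hc : ∀ a, SmoothFn U (fun y => ∑ c, etaInv a c * g.val y (X y) (e c y)) := fun a =>
    SmoothFn.sum fun c _ => (smoothFn_const _).mul (g.smoothFn hX (hF.smoothField c))
  have hs : ∀ a ∈ Finset.univ,
      SmoothField U ((fun y => ∑ c, etaInv a c * g.val y (X y) (e c y)) • e a) := fun a _ =>
    (hF.smoothField a).smul (hc a)
  rw [hT.congr hW i (SmoothField.sum hs) (fun y hy => ?_) hx, hT.sum hW i _ hs hx]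
  · exact Finset.sum_congr rfl fun a _ => hT.smul hW i (hc a) (hF.smoothField a) hx
  · conv_lhs => rw [g.expand (hF.orthonormal y hy) (X y)]
    simp

/-- The arguments are exchanged one slot at a time. Expanding a slot in the frame shows that only
its value at `x` enters. -/
theorem eq_of_eq_at (hF : IsMovingFrame g U e) (hT : IsTensorial U T)
    (hW : ∀ i, SmoothField U (W i)) (hW' : ∀ i, SmoothField U (W' i)) (hx : x ∈ U)
    (h : ∀ i, W' i x = W i x) : T W' x = T W x := by
  classical
  have key : ∀ s : Finset (Fin n), T (fun i => if i ∈ s then W' i else W i) x = T W x := by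
    intro s
    induction s using Finset.induction_on with
    | empty => simp
    | insert k s hk ih =>
      have hV : ∀ i, SmoothField U (if i ∈ s then W' i else W i) := fun i => by
        split_ifs
        exacts [hW' i, hW i]
      have h1 : (fun i => if i ∈ insert k s then W' i else W i)
          = Function.update (fun i => if i ∈ s then W' i else W i) k (W' k) := by
        funext i
        by_cases hik : i = k
        · subst hik; simp
        · simp [hik]
      have h2 : (fun i => if i ∈ s then W' i else W i)
          = Function.update (fun i => if i ∈ s then W' i else W i) k (W k) := by
        funext i
        by_cases hik : i = k
        · subst hik; simp [hk]
        · simp [hik]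
      rw [← ih, h1]
      conv_rhs => rw [h2]
      rw [hT.update_frame hF hV k (hW' k) hx, hT.update_frame hF hV k (hW k) hx, h k]
  simpa using key Finset.univ

theorem frame_expand (hF : IsMovingFrame g U e) (hT : IsTensorial U T)
    (hW : ∀ i, SmoothField U (W i)) (hx : x ∈ U) (c : Fin n → Fin 3 → ℝ)
    (h : ∀ i, W i x = ∑ b, c i b • e b x) :
    T W x = ∑ b : Fin n → Fin 3, (∏ i, c i (b i)) * T (fun i => e (b i)) x := by
  have hs : ∀ c : Fin 3 → ℝ, SmoothField U (∑ b, c b • e b) := fun c =>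
    SmoothField.sum fun b _ => (hF.smoothField b).const_smul (c b)
  have hup : ∀ [DecidableEq (Fin n)] (m : Fin n → Fin 3 → ℝ) (i : Fin n) (u : Fin 3 → ℝ),
      (fun k => ∑ b, Function.update m i u k b • e b)
        = Function.update (fun k => ∑ b, m k b • e b) i (∑ b, u b • e b) := by
    intro _ m i u
    funext k
    by_cases hk : k = i
    · subst hk; simp
    · simp [hk]
  -- Restricting to combinations of the frame with constant coefficients turns `T` at `x` into a
  -- real multilinear map on coefficient vectors, to which the standard expansion applies.
  let φ : MultilinearMap ℝ (fun _ : Fin n => Fin 3 → ℝ) ℝ :=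
    { toFun := fun m => T (fun k => ∑ b, m k b • e b) x
      map_update_add' := by
        intro _ m i u v
        have : (∑ b, (u + v) b • e b) = (∑ b, u b • e b) + ∑ b, v b • e b := by
          simp [add_smul, Finset.sum_add_distrib]
        rw [hup, hup, hup, this]
        convert hT.add (fun k => hs (m k)) i (hs u) (hs v) hx
      map_update_smul' := by
        intro _ m i t u
        have : (∑ b, (t • u) b • e b) = (fun _ : M => t) • ∑ b, u b • e b := by
          funext y
          simp [mul_smul, Finset.smul_sum]
        rw [hup, hup, this, smul_eq_mul]
        convert hT.smul (fun k => hs (m k)) i (smoothFn_const t) (hs u) hx }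
  have h1 : T W x = φ c :=
    hT.eq_of_eq_at hF (fun k => hs (c k)) hW hx fun i => by rw [h i]; simp
  have h2 : c = fun i => ∑ b, c i b • (Pi.single b 1 : Fin 3 → ℝ) := by
    funext i k
    simp [Pi.single_apply]
  rw [h1, h2, MultilinearMap.map_sum]
  refine Finset.sum_congr rfl fun b _ => ?_
  rw [MultilinearMap.map_smul_univ, smul_eq_mul, ← h2]
  congr 1
  change T _ x = _
  congr 1
  funext i
  simp [Pi.single_apply]

end IsTensorial

theorem isTensorial_curvDeriv (hF : IsMovingFrame g U e) (j : ℕ) :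
    IsTensorial U (curvDeriv g j) := by
  induction j with
  | zero =>
    have hadd : ∀ {X Y Y' Z : VField M}, SmoothField U X → SmoothField U Y → SmoothField U Y' →
        SmoothField U Z → ∀ {x}, x ∈ U →
        curvOp g X (Y + Y') Z x = curvOp g X Y Z x + curvOp g X Y' Z x := by
      intro X Y Y' Z hX hY hY' hZ x hx
      rw [hF.curvOp_swap hx hX (hY.add hY') hZ, hF.curvOp_add_left hx hY hY' hX hZ,
        hF.curvOp_swap hx hX hY hZ, hF.curvOp_swap hx hX hY' hZ, neg_add]
    have hsmul : ∀ {f : M → ℝ} {X Y Z : VField M}, SmoothFn U f → SmoothField U X →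
        SmoothField U Y → SmoothField U Z → ∀ {x}, x ∈ U →
        curvOp g X (f • Y) Z x = f x • curvOp g X Y Z x := by
      intro f X Y Z hf hX hY hZ x hx
      rw [hF.curvOp_swap hx hX (hY.smul hf) hZ, hF.curvOp_smul_left hx hf hY hX hZ,
        hF.curvOp_swap hx hX hY hZ, smul_neg]
    exact
    { smooth := fun hW => g.smoothFn (hW 0) (hF.curvOp (hW 2) (hW 3) (hW 1))
      add := by
        intro W hW i X Y hX hY x hx
        have h0 := hW 0
        have h1 := hW 1
        have h2 := hW 2
        have h3 := hW 3
        simp only [curvDeriv]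
        change Fin 4 at i
        fin_cases i
        · simp
        · simp [hF.curvOp_add_right hx h2 h3 hX hY]
        · simp [hF.curvOp_add_left hx hX hY h3 h1]
        · simp [hadd h2 hX hY h1 hx]
      smul := by
        intro W hW i f X hf hX x hx
        have h0 := hW 0
        have h1 := hW 1
        have h2 := hW 2
        have h3 := hW 3
        simp only [curvDeriv]
        change Fin 4 at i
        fin_cases i
        · simp
        · simp [hF.curvOp_smul_right hx h2 h3 hf hX]
        · simp [hF.curvOp_smul_left hx hf hX h3 h1]
        · simp [hsmul hf h2 hX h1 hx] }
  -- Each further `curvDeriv` is by definition the `covDeriv` of the preceding one.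
  | succ j ih => exact ih.covDeriv hF

/-- Components in two moving frames are related by the matrix relating the frames. -/
theorem curvComp_eq_pull {e' : Fin 3 → VField M} (hF : IsMovingFrame g U e)
    (hF' : IsMovingFrame g U e') (hx : x ∈ U) (p : ℕ) (A : Matrix (Fin 3) (Fin 3) ℝ)
    (h : ∀ a, e' a x = ∑ b, A b a • e b x) :
    curvComp g p e' x = pull A (curvComp g p e x) := by
  funext j a
  exact (isTensorial_curvDeriv hF j).frame_expand hF (fun i => hF'.smoothField (a i)) hx
    (fun i b => A b (a i)) fun i => h (a i)

end FrameChange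

/-! ### Connection components, structure equations and curvature symmetries. -/

section Structure

variable {M : Type*} [TopologicalSpace M] [ChartedSpace (EuclideanSpace ℝ (Fin 3)) M]
  [IsManifold (𝓡 3) ∞ M] {g : LorentzMetric M} {U : Set M} {e : Fin 3 → VField M}
  {x : M} {f f' : M → ℝ} {X Y Z W : VField M}

/-- The connection components `Γ` of a moving frame: `∇_{e_c} e_b = ∑_a Γ c b a e_a`. -/
def conn (g : LorentzMetric M) (e : Fin 3 → VField M) (c b a : Fin 3) (x : M) : ℝ :=
  ∑ d, etaInv a d * g.val x (leviCivita g (e c) (e b) x) (e d x)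

/-- The components of the curvature tensor in a moving frame. -/
def riem (g : LorentzMetric M) (e : Fin 3 → VField M) (a b c d : Fin 3) (x : M) : ℝ :=
  g.val x (e a x) (curvOp g (e c) (e d) (e b) x)

namespace IsMovingFrame

theorem smoothFn_conn (hF : IsMovingFrame g U e) (c b a : Fin 3) : SmoothFn U (conn g e c b a) :=
  SmoothFn.sum fun d _ => (smoothFn_const _).mul
    (g.smoothFn (hF.nabla (hF.smoothField c) (hF.smoothField b)) (hF.smoothField d))

theorem smoothFn_riem (hF : IsMovingFrame g U e) (a b c d : Fin 3) :
    SmoothFn U (riem g e a b c d) :=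
  g.smoothFn (hF.smoothField a)
    (hF.curvOp (hF.smoothField c) (hF.smoothField d) (hF.smoothField b))

theorem nabla_eq (hF : IsMovingFrame g U e) (hx : x ∈ U) (c b : Fin 3) :
    leviCivita g (e c) (e b) x = ∑ a, conn g e c b a x • e a x :=
  g.expand (hF.orthonormal x hx) _

/-- Differentiate the constant functions g(e_a, e_b) = η_ab. -/
theorem conn_skew (hF : IsMovingFrame g U e) (hx : x ∈ U) (c a b : Fin 3) :
    ∑ f, conn g e c b f x * eta f a + ∑ f, conn g e c a f x * eta f b = 0 := by
  have h := hF.nabla_metric hx (hF.smoothField c) (hF.smoothField b) (hF.smoothField a)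
  rw [dirDeriv_eq_zero_of_const hF.isOpen hx (fun y hy => hF.orthonormal y hy b a),
    hF.nabla_eq hx, hF.nabla_eq hx] at h
  have hs : ∀ f, eta b f = eta f b := fun f => by fin_cases b <;> fin_cases f <;> rfl
  simp only [map_sum, map_smul, sum_apply, smul_apply, smul_eq_mul, hF.orthonormal x hx, hs] at h
  exact h.symm

theorem bracket_eq (hF : IsMovingFrame g U e) (hx : x ∈ U) (c d : Fin 3) :
    bracket (e c) (e d) x = ∑ a, (conn g e c d a x - conn g e d c a x) • e a x := by
  rw [← hF.nabla_torsion hx (hF.smoothField c) (hF.smoothField d), hF.nabla_eq hx, hF.nabla_eq hx,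
    ← Finset.sum_sub_distrib]
  simp only [sub_smul]

theorem dirDeriv_comm (hF : IsMovingFrame g U e) (hx : x ∈ U) (hf : SmoothFn U f) (c d : Fin 3) :
    CurvHom.dirDeriv (e c) (CurvHom.dirDeriv (e d) f) x
      - CurvHom.dirDeriv (e d) (CurvHom.dirDeriv (e c) f) x
      = ∑ a, (conn g e c d a x - conn g e d c a x) * CurvHom.dirDeriv (e a) f x := by
  rw [← hF.dirDeriv_bracket hx (hF.smoothField c) (hF.smoothField d) hf]
  simp only [CurvHom.dirDeriv, hF.bracket_eq hx, map_sum, map_smul, smul_eq_mul]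

theorem nabla_sum_right (hF : IsMovingFrame g U e) (hx : x ∈ U) (hX : SmoothField U X)
    {h : Fin 3 → M → ℝ} (hh : ∀ a, SmoothFn U (h a)) :
    leviCivita g X (∑ a, h a • e a) x
      = ∑ a, (h a x • leviCivita g X (e a) x + CurvHom.dirDeriv X (h a) x • e a x) := by
  have hs := fun a => (hF.smoothField a).smul (hh a)
  simp only [Fin.sum_univ_three]
  rw [hF.nabla_add_right hx hX ((hs 0).add (hs 1)) (hs 2), hF.nabla_add_right hx hX (hs 0) (hs 1)]
  simp only [hF.nabla_smul_right hx hX (hh _) (hF.smoothField _)]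

theorem nabla_sum_left (hF : IsMovingFrame g U e) (hx : x ∈ U) (hY : SmoothField U Y)
    {h : Fin 3 → M → ℝ} (hh : ∀ a, SmoothFn U (h a)) :
    leviCivita g (∑ a, h a • e a) Y x = ∑ a, h a x • leviCivita g (e a) Y x := by
  have hs := fun a => (hF.smoothField a).smul (hh a)
  simp only [Fin.sum_univ_three]
  rw [hF.nabla_add_left hx ((hs 0).add (hs 1)) (hs 2) hY, hF.nabla_add_left hx (hs 0) (hs 1) hY]
  simp only [hF.nabla_smul_left hx (hF.smoothField _) (hh _) hY]

/-- Cartan's second structure equation. -/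
theorem curvOp_eq (hF : IsMovingFrame g U e) (hx : x ∈ U) (c d b : Fin 3) :
    CurvHom.curvOp g (e c) (e d) (e b) x = ∑ a,
      (CurvHom.dirDeriv (e c) (conn g e d b a) x - CurvHom.dirDeriv (e d) (conn g e c b a) x
        + ∑ f, (conn g e d b f x * conn g e c f a x - conn g e c b f x * conn g e d f a x)
        - ∑ f, (conn g e c d f x - conn g e d c f x) * conn g e f b a x) • e a x := by
  have key : ∀ c d : Fin 3, leviCivita g (e c) (leviCivita g (e d) (e b)) x
      = ∑ a, (conn g e d b a x • leviCivita g (e c) (e a) x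
        + CurvHom.dirDeriv (e c) (conn g e d b a) x • e a x) := by
    intro c d
    rw [← hF.nabla_sum_right hx (hF.smoothField c) (hF.smoothFn_conn d b)]
    exact hF.nabla_congr hx (hF.smoothField c)
      (SmoothField.sum fun a _ => (hF.smoothField a).smul (hF.smoothFn_conn d b a))
      (fun _ _ => rfl) fun y hy => by rw [hF.nabla_eq hy]; simp
  have h3 : leviCivita g (bracket (e c) (e d)) (e b) x
      = ∑ a, (conn g e c d a x - conn g e d c a x) • leviCivita g (e a) (e b) x := by
    have hs := fun a => (hF.smoothFn_conn c d a).sub (hF.smoothFn_conn d c a)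
    rw [← hF.nabla_sum_left hx (hF.smoothField b) hs]
    exact hF.nabla_congr hx
      (SmoothField.sum fun a _ => (hF.smoothField a).smul (hs a)) (hF.smoothField b)
      (fun y hy => by rw [hF.bracket_eq hy]; simp) (fun _ _ => rfl)
  simp only [bracket] at h3
  simp only [CurvHom.curvOp, key, h3, hF.nabla_eq hx, Fin.sum_univ_three]
  module

theorem riem_eq (hF : IsMovingFrame g U e) (hx : x ∈ U) (a b c d : Fin 3) :
    riem g e a b c d x = ∑ h, eta a h *
      (CurvHom.dirDeriv (e c) (conn g e d b h) x - CurvHom.dirDeriv (e d) (conn g e c b h) x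
        + ∑ f, (conn g e d b f x * conn g e c f h x - conn g e c b f x * conn g e d f h x)
        - ∑ f, (conn g e c d f x - conn g e d c f x) * conn g e f b h x) := by
  simp only [riem, hF.curvOp_eq hx, map_sum, map_smul, smul_eq_mul, hF.orthonormal x hx]
  exact Finset.sum_congr rfl fun h _ => mul_comm _ _

/-! #### Algebraic symmetries of the curvature tensor -/

/-- Vanishing torsion gives ∇_X∇_Y Z - ∇_X∇_Z Y - ∇_{[Y,Z]} X = [X, [Y, Z]]. The cyclic sum of these
identities is the Jacobi identity. -/
theorem curvOp_bianchi (hF : IsMovingFrame g U e) (hx : x ∈ U) (hX : SmoothField U X)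
    (hY : SmoothField U Y) (hZ : SmoothField U Z) :
    CurvHom.curvOp g X Y Z x + CurvHom.curvOp g Y Z X x + CurvHom.curvOp g Z X Y x = 0 := by
  have hU := hF.isOpen
  have key : ∀ {X Y Z : VField M}, SmoothField U X → SmoothField U Y → SmoothField U Z →
      leviCivita g X (leviCivita g Y Z) x - leviCivita g X (leviCivita g Z Y) x
        - leviCivita g (bracket Y Z) X x = bracket X (bracket Y Z) x := by
    intro X Y Z hX hY hZ
    have hYZ := hY.bracket hU hZ
    have hZY := hF.nabla hZ hY
    have h : leviCivita g X (leviCivita g Y Z) x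
        = leviCivita g X (bracket Y Z) x + leviCivita g X (leviCivita g Z Y) x := by
      rw [← hF.nabla_add_right hx hX hYZ hZY]
      exact hF.nabla_congr hx hX (hYZ.add hZY) (fun _ _ => rfl) fun y hy => by
        simp [← hF.nabla_torsion hy hY hZ]
    rw [h, ← hF.nabla_torsion hx hX hYZ]
    abel
  have h1 := key hX hY hZ
  have h2 := key hY hZ hX
  have h3 := key hZ hX hY
  have hJ := bracket_jacobi hU hx hX hY hZ
  have h4 : bracket Y (bracket Z X) x = -bracket Y (bracket X Z) x := by
    have hc : SmoothFn U (fun _ : M => (-1 : ℝ)) := smoothFn_const _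
    rw [bracket_congr hU hx (fun _ _ => rfl)
      (fun y _ => by rw [bracket_swap]; simp :
        ∀ y ∈ U, bracket Z X y = ((fun _ : M => (-1 : ℝ)) • bracket X Z) y),
      bracket_smul_right hU hx hc (hX.bracket hU hZ)]
    simp
  have h5 := bracket_swap Z (bracket X Y) x
  rw [h4] at h2
  rw [h5] at h3
  simp only [CurvHom.curvOp]
  simp only [bracket] at *
  linear_combination (norm := module) h1 + h2 + h3 + hJ

/-- Apply X Y - Y X - [X, Y] = 0 to the function g(Z, W). The terms in which both entries are
differentiated once are symmetric in X and Y and drop out. -/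
theorem curvOp_skew (hF : IsMovingFrame g U e) (hx : x ∈ U) (hX : SmoothField U X)
    (hY : SmoothField U Y) (hZ : SmoothField U Z) (hW : SmoothField U W) :
    g.val x (CurvHom.curvOp g X Y Z x) (W x) + g.val x (Z x) (CurvHom.curvOp g X Y W x) = 0 := by
  have hU := hF.isOpen
  have key : ∀ {X Y : VField M}, SmoothField U X → SmoothField U Y →
      CurvHom.dirDeriv X (CurvHom.dirDeriv Y (fun y => g.val y (Z y) (W y))) x
        = g.val x (leviCivita g X (leviCivita g Y Z) x) (W x)
          + g.val x (leviCivita g Y Z x) (leviCivita g X W x)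
          + (g.val x (leviCivita g X Z x) (leviCivita g Y W x)
          + g.val x (Z x) (leviCivita g X (leviCivita g Y W) x)) := by
    intro X Y hX hY
    have hYZ := hF.nabla hY hZ
    have hYW := hF.nabla hY hW
    rw [← hF.nabla_metric hx hX hYZ hW, ← hF.nabla_metric hx hX hZ hYW,
      ← dirDeriv_add hU hx (g.smoothFn hYZ hW) (g.smoothFn hZ hYW)]
    exact dirDeriv_congr hU hx (fun y hy => hF.nabla_metric hy hY hZ hW) X
  have h := hF.dirDeriv_bracket hx hX hY (g.smoothFn hZ hW)
  rw [key hX hY, key hY hX, hF.nabla_metric hx (hX.bracket hU hY) hZ hW] at h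
  simp only [bracket] at h
  simp only [CurvHom.curvOp, map_sub, sub_apply]
  linarith

theorem riem_swap_right (hF : IsMovingFrame g U e) (hx : x ∈ U) (a b c d : Fin 3) :
    riem g e a b c d x = -riem g e a b d c x := by
  rw [riem, hF.curvOp_swap hx (hF.smoothField c) (hF.smoothField d) (hF.smoothField b)]
  simp [riem]

theorem riem_swap_left (hF : IsMovingFrame g U e) (hx : x ∈ U) (a b c d : Fin 3) :
    riem g e a b c d x = -riem g e b a c d x := by
  have h := hF.curvOp_skew hx (hF.smoothField c) (hF.smoothField d) (hF.smoothField b)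
    (hF.smoothField a)
  rw [g.symm] at h
  simp only [riem]
  linarith

theorem riem_bianchi (hF : IsMovingFrame g U e) (hx : x ∈ U) (a b c d : Fin 3) :
    riem g e a b c d x + riem g e a c d b x + riem g e a d b c x = 0 := by
  have h := congrArg (g.val x (e a x)) (hF.curvOp_bianchi hx (hF.smoothField c)
    (hF.smoothField d) (hF.smoothField b))
  simp only [map_add, map_zero] at h
  simp only [riem]
  linarith

end IsMovingFrame

/-- The components of a covariant derivative in a moving frame. -/
theorem IsTensorial.covDeriv_frame {n : ℕ} {T : (Fin n → VField M) → M → ℝ}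
    (hF : IsMovingFrame g U e) (hT : IsTensorial U T) (hx : x ∈ U) (a : Fin (n + 1) → Fin 3) :
    CurvHom.covDeriv g T (fun i => e (a i)) x
      = dirDeriv (e (a (Fin.last n))) (T (fun i => e (a i.castSucc))) x
        - ∑ i : Fin n, ∑ f, conn g e (a (Fin.last n)) (a i.castSucc) f x
          * T (fun k => e (Function.update (fun i : Fin n => a i.castSucc) i f k)) x := by
  simp only [CurvHom.covDeriv]
  congr 1
  refine Finset.sum_congr rfl fun i _ => ?_
  rw [hT.update_frame hF (fun k => hF.smoothField (a k.castSucc)) i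
    (hF.nabla (hF.smoothField _) (hF.smoothField _)) hx]
  refine Finset.sum_congr rfl fun f _ => ?_
  have : Function.update (fun i : Fin n => e (a i.castSucc)) i (e f)
      = fun k => e (Function.update (fun i : Fin n => a i.castSucc) i f k) := by
    funext k
    by_cases hk : k = i
    · subst hk; simp
    · simp [hk]
  rw [this]
  rfl

end Structure

/-! ### Consequences of boost invariance of R and ∇R for the connection. -/

section BoostInvariant

variable {M : Type*} [TopologicalSpace M] [ChartedSpace (EuclideanSpace ℝ (Fin 3)) M]

/-- `f` is smooth on `U` with derivative `d` at `x` along `X`. -/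
def HasDirDeriv (U : Set M) (x : M) (X : VField M) (f : M → ℝ) (d : ℝ) : Prop :=
  SmoothFn U f ∧ dirDeriv X f x = d

namespace HasDirDeriv

variable {U : Set M} {x : M} {X : VField M} {f f' : M → ℝ} {d d' : ℝ}

theorem add (h : HasDirDeriv U x X f d) (h' : HasDirDeriv U x X f' d') (hU : IsOpen U)
    (hx : x ∈ U) : HasDirDeriv U x X (fun y => f y + f' y) (d + d') :=
  ⟨h.1.add h'.1, by rw [dirDeriv_add hU hx h.1 h'.1, h.2, h'.2]⟩

theorem sub (h : HasDirDeriv U x X f d) (h' : HasDirDeriv U x X f' d') (hU : IsOpen U)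
    (hx : x ∈ U) : HasDirDeriv U x X (fun y => f y - f' y) (d - d') :=
  ⟨h.1.sub h'.1, by rw [dirDeriv_sub hU hx h.1 h'.1, h.2, h'.2]⟩

theorem mul (h : HasDirDeriv U x X f d) (h' : HasDirDeriv U x X f' d') (hU : IsOpen U)
    (hx : x ∈ U) : HasDirDeriv U x X (fun y => f y * f' y) (f x * d' + f' x * d) :=
  ⟨h.1.mul h'.1, by rw [dirDeriv_mul hU hx h.1 h'.1, h.2, h'.2]⟩

theorem const_mul (h : HasDirDeriv U x X f d) (c : ℝ) (hU : IsOpen U)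
    (hx : x ∈ U) : HasDirDeriv U x X (fun y => c * f y) (c * d) :=
  ⟨(smoothFn_const c).mul h.1, by rw [dirDeriv_const_mul hU hx h.1, h.2]⟩

theorem sum {ι : Type*} (s : Finset ι) {F : ι → M → ℝ} {D : ι → ℝ}
    (h : ∀ i, HasDirDeriv U x X (F i) (D i)) (hU : IsOpen U) (hx : x ∈ U) :
    HasDirDeriv U x X (fun y => ∑ i ∈ s, F i y) (∑ i ∈ s, D i) := by
  classical
  induction s using Finset.induction_on with
  | empty => exact ⟨by simpa using smoothFn_const 0, by simp⟩
  | insert i s hi ih => simpa only [Finset.sum_insert hi] using (h i).add ih hU hx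

theorem unique (h : HasDirDeriv U x X f d) (h' : HasDirDeriv U x X f' d') (hU : IsOpen U)
    (hx : x ∈ U) (hff : ∀ y ∈ U, f y = f' y) : d = d' := by
  rw [← h.2, ← h'.2]
  exact dirDeriv_congr hU hx hff X

end HasDirDeriv

variable [IsManifold (𝓡 3) ∞ M] {g : LorentzMetric M} {U : Set M} {e : Fin 3 → VField M} {x : M}

/-- The boost weight of an index. -/
def boost : Fin 3 → ℤ := ![1, 0, -1]

/-- All components of `∇^j R` in the moving frame `e` with nonzero boost weight vanish on `U`. -/
def BoostInvariant (g : LorentzMetric M) (U : Set M) (e : Fin 3 → VField M) (j : ℕ) : Prop :=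
  ∀ x ∈ U, ∀ a : Fin (4 + j) → Fin 3, ∑ i, boost (a i) ≠ 0 →
    curvDeriv g j (fun i => e (a i)) x = 0

theorem riem_eq_curvDeriv (a b c d : Fin 3) (x : M) :
    riem g e a b c d x = curvDeriv g 0 (fun i => e (![a, b, c, d] i)) x := rfl

theorem BoostInvariant.riem_eq_zero (h : BoostInvariant g U e 0) (hx : x ∈ U) (a b c d : Fin 3)
    (hw : boost a + boost b + boost c + boost d ≠ 0) : riem g e a b c d x = 0 := by
  rw [riem_eq_curvDeriv]
  refine h x hx ![a, b, c, d] ?_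
  rw [Fin.sum_univ_four]
  exact hw

theorem eq_zero_of_skew {G : Fin 3 → Fin 3 → ℝ} (h : ∀ a b, G a b = -G b a) (h01 : G 0 1 = 0)
    (h02 : G 0 2 = 0) (h12 : G 1 2 = 0) (a b : Fin 3) : G a b = 0 := by
  have h0 := h 0 0
  have h1 := h 1 1
  have h2 := h 2 2
  have h3 := h 1 0
  have h4 := h 2 0
  have h5 := h 2 1
  fin_cases a <;> fin_cases b <;> simp <;> linarith

theorem nablaRiem_eq (hF : IsMovingFrame g U e) (hx : x ∈ U) (a b c d h : Fin 3) :
    curvDeriv g 1 (fun i => e (![a, b, c, d, h] i)) x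
      = dirDeriv (e h) (riem g e a b c d) x
        - ∑ f, (conn g e h a f x * riem g e f b c d x + conn g e h b f x * riem g e a f c d x
          + conn g e h c f x * riem g e a b f d x + conn g e h d f x * riem g e a b c f x) := by
  have h1 := IsTensorial.covDeriv_frame hF (isTensorial_curvDeriv hF 0) hx ![a, b, c, d, h]
  refine h1.trans ?_
  simp only [Finset.sum_add_distrib]
  congr 1
  exact Fin.sum_univ_four _

namespace BoostInvariant

/-- Skew-symmetry of the connection components. -/
theorem _root_.CurvHom.IsMovingFrame.conn_table (hF : IsMovingFrame g U e) (hx : x ∈ U)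
    (c : Fin 3) : conn g e c 0 2 x = 0 ∧ conn g e c 2 0 x = 0 ∧ conn g e c 1 1 x = 0
      ∧ conn g e c 2 2 x = -conn g e c 0 0 x ∧ conn g e c 0 1 x = 2 * conn g e c 1 2 x
      ∧ conn g e c 2 1 x = 2 * conn g e c 1 0 x := by
  have h00 := hF.conn_skew hx c 0 0
  have h01 := hF.conn_skew hx c 0 1
  have h02 := hF.conn_skew hx c 0 2
  have h11 := hF.conn_skew hx c 1 1
  have h12 := hF.conn_skew hx c 1 2
  have h22 := hF.conn_skew hx c 2 2
  simp [Fin.sum_univ_three, eta] at h00 h01 h02 h11 h12 h22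
  refine ⟨?_, ?_, ?_, ?_, ?_, ?_⟩ <;> linarith

/-- R₀₁₀₂ and R₀₂₁₂ have weights 1 and -1, hence vanish with their derivatives. Their covariant
derivatives along e_c therefore reduce to connection terms, which are `conn g e c 1 2` and `conn g e
c 1 0` times the nonzero factor of `hne`, up to sign. These covariant derivatives vanish whenever
the total weight is nonzero: c = 0, 1 in the first case and c = 1, 2 in the second. -/
theorem conn_eq_zero (hF : IsMovingFrame g U e) (h0 : BoostInvariant g U e 0)
    (h1 : BoostInvariant g U e 1) (hx : x ∈ U)
    (hne : riem g e 0 2 0 2 x + 2 * riem g e 0 1 1 2 x ≠ 0) :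
    conn g e 0 1 2 x = 0 ∧ conn g e 1 1 2 x = 0 ∧ conn g e 1 1 0 x = 0 ∧ conn g e 2 1 0 x = 0 := by
  have hU := hF.isOpen
  have hz : ∀ a b c d, boost a + boost b + boost c + boost d ≠ 0 → riem g e a b c d x = 0 :=
    fun a b c d => h0.riem_eq_zero hx a b c d
  have hd : ∀ a b c d, boost a + boost b + boost c + boost d ≠ 0 → ∀ X,
      dirDeriv X (riem g e a b c d) x = 0 := fun a b c d hw X =>
    dirDeriv_eq_zero_of_const hU hx (fun y hy => h0.riem_eq_zero hy a b c d hw) X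
  have hl : ∀ a c d, riem g e a a c d x = 0 := fun a c d => by
    have := hF.riem_swap_left hx a a c d
    linarith
  have hr : ∀ a b c, riem g e a b c c x = 0 := fun a b c => by
    have := hF.riem_swap_right hx a b c c
    linarith
  have hv : ∀ c, boost 0 + boost 1 + boost 0 + boost 2 + boost c ≠ 0 → conn g e c 1 2 x = 0 := by
    intro c hc
    have h := nablaRiem_eq hF hx 0 1 0 2 c
    rw [h1 x hx ![0, 1, 0, 2, c] (by rw [Fin.sum_univ_five]; exact hc)] at h
    obtain ⟨t1, t2, t3, t4, t5, t6⟩ := hF.conn_table hx c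
    rw [hd 0 1 0 2 (by decide)] at h
    simp only [Fin.sum_univ_three, t1, t2, t3, t4, t5, t6, hl, hr, hz 0 1 0 2 (by decide),
      hz 0 1 0 1 (by decide)] at h
    have : conn g e c 1 2 x * (riem g e 0 2 0 2 x + 2 * riem g e 0 1 1 2 x) = 0 := by
      linear_combination h
    exact (mul_eq_zero.1 this).resolve_right hne
  have hu : ∀ c, boost 0 + boost 2 + boost 1 + boost 2 + boost c ≠ 0 → conn g e c 1 0 x = 0 := by
    intro c hc
    have h := nablaRiem_eq hF hx 0 2 1 2 c
    rw [h1 x hx ![0, 2, 1, 2, c] (by rw [Fin.sum_univ_five]; exact hc)] at h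
    obtain ⟨t1, t2, t3, t4, t5, t6⟩ := hF.conn_table hx c
    rw [hd 0 2 1 2 (by decide)] at h
    simp only [Fin.sum_univ_three, t1, t2, t3, t4, t5, t6, hl, hr, hz 0 2 1 2 (by decide),
      hz 1 2 1 2 (by decide)] at h
    have : conn g e c 1 0 x * (riem g e 0 2 0 2 x + 2 * riem g e 0 1 1 2 x) = 0 := by
      linear_combination h
    exact (mul_eq_zero.1 this).resolve_right hne
  exact ⟨hv 0 (by decide), hv 1 (by decide), hu 1 (by decide), hu 2 (by decide)⟩

/-- The twist of the boost-invariant congruence is constant, and its divergence vanishes. -/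
theorem twist_const (hF : IsMovingFrame g U e) (h0 : BoostInvariant g U e 0)
    (h1 : BoostInvariant g U e 1)
    (hne : ∀ x ∈ U, riem g e 0 2 0 2 x + 2 * riem g e 0 1 1 2 x ≠ 0)
    (hQ : ∀ x ∈ U, dirDeriv (e 1) (riem g e 0 2 0 2) x = 0) :
    (∀ x ∈ U, conn g e 0 1 0 x = -conn g e 2 1 2 x) ∧
      ∀ x ∈ U, ∀ c, dirDeriv (e c) (conn g e 2 1 2) x = 0 := by
  have hU := hF.isOpen
  have tab : ∀ y ∈ U, ∀ c, _ := fun y hy c => hF.conn_table hy c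
  have van : ∀ y ∈ U, _ := fun y hy => conn_eq_zero hF h0 h1 hy (hne y hy)
  set a := conn g e 2 1 2 with ha
  set b := conn g e 0 1 0 with hb
  set w : Fin 3 → M → ℝ := fun c => conn g e c 0 0 with hw
  have sa : SmoothFn U a := hF.smoothFn_conn _ _ _
  have sb : SmoothFn U b := hF.smoothFn_conn _ _ _
  have sw : ∀ c, SmoothFn U (w c) := fun c => hF.smoothFn_conn _ _ _
  have sD : ∀ c {f : M → ℝ}, SmoothFn U f → SmoothFn U (dirDeriv (e c) f) := fun c f hf =>
    hF.dirDeriv (hF.smoothField c) hf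
  have dv : ∀ y ∈ U, ∀ X, dirDeriv X (conn g e 0 1 2) y = 0 ∧ dirDeriv X (conn g e 1 1 2) y = 0
      ∧ dirDeriv X (conn g e 1 1 0) y = 0 ∧ dirDeriv X (conn g e 2 1 0) y = 0 := fun y hy X =>
    ⟨dirDeriv_eq_zero_of_const hU hy (fun z hz => (van z hz).1) X,
      dirDeriv_eq_zero_of_const hU hy (fun z hz => (van z hz).2.1) X,
      dirDeriv_eq_zero_of_const hU hy (fun z hz => (van z hz).2.2.1) X,
      dirDeriv_eq_zero_of_const hU hy (fun z hz => (van z hz).2.2.2) X⟩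
  -- the structure equations
  have str : ∀ y ∈ U,
      riem g e 2 1 0 1 y = dirDeriv (e 1) b y + b y ^ 2
      ∧ riem g e 0 1 2 1 y = dirDeriv (e 1) a y + a y ^ 2
      ∧ riem g e 2 1 0 2 y = dirDeriv (e 2) b y
      ∧ riem g e 0 1 0 2 y = -dirDeriv (e 0) a y
      ∧ riem g e 2 0 0 1 y = -(dirDeriv (e 0) (w 1) y - dirDeriv (e 1) (w 0) y
        - (b y - w 1 y) * w 0 y)
      ∧ riem g e 2 0 1 2 y = -(dirDeriv (e 1) (w 2) y - dirDeriv (e 2) (w 1) y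
        + (w 1 y + a y) * w 2 y)
      ∧ riem g e 2 0 0 2 y = -(dirDeriv (e 0) (w 2) y - dirDeriv (e 2) (w 0) y
        + 2 * (a y * b y) - 2 * ((b y - a y) * w 1 y) + 2 * (w 0 y * w 2 y)) := by
    intro y hy
    obtain ⟨p1, p2, p3, p4, p5, p6⟩ := tab y hy 0
    obtain ⟨q1, q2, q3, q4, q5, q6⟩ := tab y hy 1
    obtain ⟨r1, r2, r3, r4, r5, r6⟩ := tab y hy 2
    obtain ⟨v1, v2, v3, v4⟩ := van y hy
    have wv : ∀ c, conn g e c 0 0 = w c := fun _ => rfl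
    have dvv := dv y hy
    refine ⟨?_, ?_, ?_, ?_, ?_, ?_, ?_⟩ <;>
    · simp only [hF.riem_eq hy, Fin.sum_univ_three, p1, p2, p3, p4, p5, p6, q1, q2, q3, q4, q5, q6,
        r1, r2, r3, r4, r5, r6, v1, v2, v3, v4, (dvv _).1, (dvv _).2.1, (dvv _).2.2.1,
        (dvv _).2.2.2, ← ha, ← hb, wv, eta, Matrix.cons_val, Matrix.of_apply]
      ring
  -- By the curvature symmetries R₂₁₀₁ = R₀₁₂₁ = -R₀₁₁₂, so `a` and `b` satisfy one and the same
  -- Riccati equation along `e 1`.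
  have kap : ∀ y ∈ U, dirDeriv (e 1) b y + b y ^ 2 = -riem g e 0 1 1 2 y ∧
      dirDeriv (e 1) a y + a y ^ 2 = -riem g e 0 1 1 2 y := by
    intro y hy
    obtain ⟨s1, s2, -⟩ := str y hy
    have t1 := hF.riem_swap_left hy 2 1 0 1
    have t2 := hF.riem_swap_right hy 0 1 2 1
    have t3 := hF.riem_bianchi hy 1 0 1 2
    have t4 := hF.riem_swap_left hy 1 1 2 0
    have t5 := hF.riem_swap_left hy 1 0 1 2
    constructor <;> linarith
  have Da : ∀ y ∈ U, dirDeriv (e 0) a y = 0 := fun y hy => by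
    have := (str y hy).2.2.2.1
    rw [h0.riem_eq_zero hy 0 1 0 2 (by decide)] at this
    linarith
  have Db : ∀ y ∈ U, dirDeriv (e 2) b y = 0 := fun y hy => by
    have := (str y hy).2.2.1
    rw [h0.riem_eq_zero hy 2 1 0 2 (by decide)] at this
    linarith
  -- These three equations express the boost part of the curvature through the boost connection `w`.
  -- Only the 02 component can be nonzero, as the other two have nonzero weight.
  have E01 : ∀ y ∈ U, dirDeriv (e 0) (w 1) y - dirDeriv (e 1) (w 0) y
      - (b y - w 1 y) * w 0 y = 0 := fun y hy => by
    have := (str y hy).2.2.2.2.1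
    rw [h0.riem_eq_zero hy 2 0 0 1 (by decide)] at this
    linarith
  have E12 : ∀ y ∈ U, dirDeriv (e 1) (w 2) y - dirDeriv (e 2) (w 1) y
      + (w 1 y + a y) * w 2 y = 0 := fun y hy => by
    have := (str y hy).2.2.2.2.2.1
    rw [h0.riem_eq_zero hy 2 0 1 2 (by decide)] at this
    linarith
  have E02 : ∀ y ∈ U, dirDeriv (e 0) (w 2) y - dirDeriv (e 2) (w 0) y
      + 2 * (a y * b y) - 2 * ((b y - a y) * w 1 y) + 2 * (w 0 y * w 2 y)
      = riem g e 0 2 0 2 y := fun y hy => by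
    have := (str y hy).2.2.2.2.2.2
    have t1 := hF.riem_swap_left hy 2 0 0 2
    linarith
  have comm : ∀ y ∈ U, ∀ {f : M → ℝ}, SmoothFn U f →
      dirDeriv (e 0) (dirDeriv (e 1) f) y - dirDeriv (e 1) (dirDeriv (e 0) f) y
        = (b y - w 1 y) * dirDeriv (e 0) f y
      ∧ dirDeriv (e 1) (dirDeriv (e 2) f) y - dirDeriv (e 2) (dirDeriv (e 1) f) y
        = -(w 1 y + a y) * dirDeriv (e 2) f y
      ∧ dirDeriv (e 0) (dirDeriv (e 2) f) y - dirDeriv (e 2) (dirDeriv (e 0) f) y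
        = -w 2 y * dirDeriv (e 0) f y + 2 * (b y - a y) * dirDeriv (e 1) f y
          - w 0 y * dirDeriv (e 2) f y := by
    intro y hy f hf
    obtain ⟨p1, p2, p3, p4, p5, p6⟩ := tab y hy 0
    obtain ⟨q1, q2, q3, q4, q5, q6⟩ := tab y hy 1
    obtain ⟨r1, r2, r3, r4, r5, r6⟩ := tab y hy 2
    obtain ⟨v1, v2, v3, v4⟩ := van y hy
    have wv : ∀ c, conn g e c 0 0 = w c := fun _ => rfl
    refine ⟨?_, ?_, ?_⟩ <;>
    · simp only [hF.dirDeriv_comm hy hf, Fin.sum_univ_three, p2, p3, p4, p6, q1, q2,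
        q4, q5, q6, r1, r3, r5, v1, v2, v3, v4, ← ha, ← hb, wv]
      ring
  -- This is the integrability condition d(dw) = 0: each of the three equations is differentiated
  -- along the remaining frame vector.
  have hab : ∀ y ∈ U, b y = -a y := by
    intro y hy
    have hD : ∀ {f : M → ℝ}, SmoothFn U f → ∀ c, HasDirDeriv U y (e c) f (dirDeriv (e c) f y) :=
      fun hf c => ⟨hf, rfl⟩
    have F02 := (((((hD (sD 0 (sw 2)) 1).sub (hD (sD 2 (sw 0)) 1) hU hy).add
      (((hD sa 1).mul (hD sb 1) hU hy).const_mul 2 hU hy) hU hy).sub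
      ((((hD sb 1).sub (hD sa 1) hU hy).mul (hD (sw 1) 1) hU hy).const_mul 2 hU hy) hU hy).add
      (((hD (sw 0) 1).mul (hD (sw 2) 1) hU hy).const_mul 2 hU hy) hU hy).unique
      (hD (hF.smoothFn_riem 0 2 0 2) 1) hU hy E02
    have F01 := ((((hD (sD 0 (sw 1)) 2).sub (hD (sD 1 (sw 0)) 2) hU hy).sub
      (((hD sb 2).sub (hD (sw 1) 2) hU hy).mul (hD (sw 0) 2) hU hy) hU hy)).unique
      (hD (smoothFn_const 0) 2) hU hy E01
    have F12 := ((((hD (sD 1 (sw 2)) 0).sub (hD (sD 2 (sw 1)) 0) hU hy).add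
      (((hD (sw 1) 0).add (hD sa 0) hU hy).mul (hD (sw 2) 0) hU hy) hU hy)).unique
      (hD (smoothFn_const 0) 0) hU hy E12
    rw [hQ y hy] at F02
    rw [dirDeriv_const, Db y hy] at F01
    rw [dirDeriv_const, Da y hy] at F12
    have c1 := (comm y hy (sw 2)).1
    have c2 := (comm y hy (sw 0)).2.1
    have c3 := (comm y hy (sw 1)).2.2
    obtain ⟨k1, k2⟩ := kap y hy
    have e01 := E01 y hy
    have e12 := E12 y hy
    have e02 := E02 y hy
    -- The commutators `c1`, `c2`, `c3` remove all second derivatives of `w`. The undifferentiated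
    -- equations and `kap` remove the first derivatives, leaving only this product.
    have : (b y + a y) * (riem g e 0 2 0 2 y + 2 * riem g e 0 1 1 2 y) = 0 := by
      linear_combination -(F02 + c1 + c2 - F01 - F12 - c3 + (a y + b y) * e02 + 2 * w 2 y * e01
        - 2 * w 0 y * e12 - (2 * a y - 2 * w 1 y) * k1 - (2 * b y + 2 * w 1 y) * k2)
    have := (mul_eq_zero.1 this).resolve_right (hne y hy)
    linarith
  refine ⟨hab, fun y hy c => ?_⟩
  have hneg : ∀ c, dirDeriv (e c) b y = -dirDeriv (e c) a y := fun c => by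
    rw [dirDeriv_congr hU hy hab, dirDeriv_neg]
  fin_cases c
  · exact Da y hy
  -- With b = -a the two Riccati equations have equal quadratic terms, so the derivative of `a`
  -- along `e 1` equals its own negative.
  · obtain ⟨k1, k2⟩ := kap y hy
    have h2 := hneg 1
    have h3 := hab y hy
    rw [h3, h2] at k1
    change dirDeriv (e 1) a y = 0
    nlinarith
  · have h2 := hneg 2
    rw [Db y hy] at h2
    change dirDeriv (e 2) a y = 0
    linarith

end BoostInvariant

end BoostInvariant

/-! ### Constancy of the components of R and ∇R. -/

section LocallyConstant

variable {M : Type*} [TopologicalSpace M] [ChartedSpace (EuclideanSpace ℝ (Fin 3)) M]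
  [IsManifold (𝓡 3) ∞ M] {g : LorentzMetric M} {U : Set M} {e : Fin 3 → VField M} {x : M}

/-- In a chart the function has zero derivative on a ball, which is connected. -/
theorem eventually_eq_of_mvfderiv_eq_zero {U : Set M} (hU : IsOpen U) (hx : x ∈ U)
    {f : M → ℝ} (hf : SmoothFn U f) (h : ∀ y ∈ U, mvfderiv (𝓡 3) f y = 0) :
    ∀ᶠ y in nhds x, f y = f x := by
  set φ := extChartAt (𝓡 3) x with hφ
  have hto : IsOpen φ.target := isOpen_extChartAt_target x
  have hcont : ContinuousOn φ.symm φ.target := continuousOn_extChartAt_symm x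
  have hO : IsOpen (φ.target ∩ φ.symm ⁻¹' U) := hcont.isOpen_inter_preimage hto hU
  have hxO : φ x ∈ φ.target ∩ φ.symm ⁻¹' U := by
    refine ⟨mem_extChartAt_target x, ?_⟩
    simpa [hφ] using hx
  obtain ⟨r, hr, hball⟩ := Metric.isOpen_iff.1 hO _ hxO
  have hd : ∀ z ∈ Metric.ball (φ x) r, HasFDerivAt (f ∘ φ.symm) (0 : _ →L[ℝ] ℝ) z := by
    intro z hz
    obtain ⟨hz1, hz2⟩ := hball hz
    have h1 : MDifferentiableAt 𝓘(ℝ, EuclideanSpace ℝ (Fin 3)) (𝓡 3) φ.symm z :=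
      ((contMDiffOn_extChartAt_symm (n := ∞) x).contMDiffAt (hto.mem_nhds hz1)).mdifferentiableAt
        (by simp)
    have h2 := hf.mdiff hU hz2
    have h3 := h2.hasMFDerivAt.comp z h1.hasMFDerivAt
    have h4 : mfderiv (𝓡 3) 𝓘(ℝ, ℝ) f (φ.symm z) = 0 := h _ hz2
    rw [h4] at h3
    have h5 : (0 : TangentSpace (𝓡 3) (φ.symm z) →L[ℝ] TangentSpace 𝓘(ℝ, ℝ) (f (φ.symm z))).comp
        (mfderiv 𝓘(ℝ, EuclideanSpace ℝ (Fin 3)) (𝓡 3) φ.symm z) = 0 :=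
      ContinuousLinearMap.zero_comp _
    rw [h5] at h3
    exact h3.hasFDerivAt
  have hc : ∀ z ∈ Metric.ball (φ x) r, (f ∘ φ.symm) z = (f ∘ φ.symm) (φ x) := fun z hz =>
    (Metric.isOpen_ball.is_const_of_fderiv_eq_zero (convex_ball _ _).isPreconnected
      (fun w hw => (hd w hw).differentiableAt.differentiableWithinAt)
      (fun w hw => (hd w hw).fderiv)) hz (Metric.mem_ball_self hr)
  filter_upwards [extChartAt_source_mem_nhds (I := 𝓡 3) x,
    (continuousAt_extChartAt (I := 𝓡 3) x).preimage_mem_nhds (Metric.ball_mem_nhds (φ x) hr)]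
    with y hy1 hy2
  have := hc _ hy2
  simp only [Function.comp, hφ, (extChartAt (𝓡 3) x).left_inv hy1,
    (extChartAt (𝓡 3) x).left_inv (mem_extChartAt_source x)] at this
  exact this

theorem IsMovingFrame.eventually_eq (hF : IsMovingFrame g U e) (hx : x ∈ U) {f : M → ℝ}
    (hf : SmoothFn U f) (h : ∀ y ∈ U, ∀ c, CurvHom.dirDeriv (e c) f y = 0) :
    ∀ᶠ y in nhds x, f y = f x := by
  refine eventually_eq_of_mvfderiv_eq_zero hF.isOpen hx hf fun y hy => ?_
  ext v
  rw [g.expand (hF.orthonormal y hy) v]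
  simp only [map_sum, map_smul, smul_eq_mul]
  refine Finset.sum_congr rfl fun c _ => ?_
  rw [show mvfderiv (𝓡 3) f y (e c y) = 0 from h y hy c]
  simp

theorem BoostInvariant.dirDeriv_riem (hF : IsMovingFrame g U e) (h0 : BoostInvariant g U e 0)
    (hx : x ∈ U) (X : VField M) (hP : dirDeriv X (riem g e 0 1 1 2) x = 0)
    (hQ : dirDeriv X (riem g e 0 2 0 2) x = 0) (a b c d : Fin 3) :
    dirDeriv X (riem g e a b c d) x = 0 := by
  have hU := hF.isOpen
  have hl : ∀ a b c d, dirDeriv X (riem g e a b c d) x = -dirDeriv X (riem g e b a c d) x :=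
    fun a b c d => by
      rw [dirDeriv_congr hU hx fun y hy => hF.riem_swap_left hy a b c d, dirDeriv_neg]
  have hr : ∀ a b c d, dirDeriv X (riem g e a b c d) x = -dirDeriv X (riem g e a b d c) x :=
    fun a b c d => by
      rw [dirDeriv_congr hU hx fun y hy => hF.riem_swap_right hy a b c d, dirDeriv_neg]
  have hz : ∀ a b c d, boost a + boost b + boost c + boost d ≠ 0 →
      dirDeriv X (riem g e a b c d) x = 0 := fun a b c d hw =>
    dirDeriv_eq_zero_of_const hU hx (fun y hy => h0.riem_eq_zero hy a b c d hw) X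
  have hP' : dirDeriv X (riem g e 1 2 0 1) x = 0 := by
    rw [dirDeriv_congr hU hx fun y hy => ?_, hP]
    have t3 := hF.riem_bianchi hy 1 0 1 2
    have t4 := hF.riem_swap_left hy 1 1 2 0
    have t5 := hF.riem_swap_left hy 1 0 1 2
    linarith
  -- Skewness in each pair leaves nine components. Those of weight zero are R₀₁₁₂, R₀₂₀₂ and R₁₂₀₁,
  -- the last equal to the first by the Bianchi identity.
  have inner : ∀ a b, dirDeriv X (riem g e a b 0 1) x = 0 → dirDeriv X (riem g e a b 0 2) x = 0 →
      dirDeriv X (riem g e a b 1 2) x = 0 → ∀ c d, dirDeriv X (riem g e a b c d) x = 0 :=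
    fun a b h1 h2 h3 => eq_zero_of_skew (fun c d => hr a b c d) h1 h2 h3
  exact eq_zero_of_skew (G := fun a b => dirDeriv X (riem g e a b c d) x)
    (fun a b => hl a b c d)
    (inner 0 1 (hz _ _ _ _ (by decide)) (hz _ _ _ _ (by decide)) hP c d)
    (inner 0 2 (hz _ _ _ _ (by decide)) hQ (hz _ _ _ _ (by decide)) c d)
    (inner 1 2 hP' (hz _ _ _ _ (by decide)) (hz _ _ _ _ (by decide)) c d) a b

/-- A boost-invariant geometry of first order with constant curvature components has constant
components of `∇R`. -/
theorem BoostInvariant.dirDeriv_curvDeriv_one (hF : IsMovingFrame g U e)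
    (h0 : BoostInvariant g U e 0) (h1 : BoostInvariant g U e 1)
    (hne : ∀ x ∈ U, riem g e 0 2 0 2 x + 2 * riem g e 0 1 1 2 x ≠ 0)
    (hP : ∀ x ∈ U, ∀ c, dirDeriv (e c) (riem g e 0 1 1 2) x = 0)
    (hQ : ∀ x ∈ U, ∀ c, dirDeriv (e c) (riem g e 0 2 0 2) x = 0) (hx : x ∈ U)
    (a : Fin (4 + 1) → Fin 3) (k : Fin 3) :
    dirDeriv (e k) (curvDeriv g 1 (fun i => e (a i))) x = 0 := by
  have hU := hF.isOpen
  have hT := isTensorial_curvDeriv hF 0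
  obtain ⟨hab, hda⟩ := twist_const hF h0 h1 hne fun y hy => hQ y hy 1
  set τ := conn g e 2 1 2 with hτ
  have hτs : SmoothFn U τ := hF.smoothFn_conn _ _ _
  have hcomp : ∀ b : Fin 4 → Fin 3, curvDeriv g 0 (fun i => e (b i))
      = riem g e (b 0) (b 1) (b 2) (b 3) := fun b => rfl
  have hR : ∀ y ∈ U, ∀ (b : Fin 4 → Fin 3) c, dirDeriv (e c) (curvDeriv g 0 (fun i => e (b i))) y
      = 0 := fun y hy b c => by
    rw [hcomp]
    exact dirDeriv_riem hF h0 hy (e c) (hP y hy c) (hQ y hy c) _ _ _ _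
  -- the connection is a constant multiple of `τ` up to a boost
  obtain ⟨C, hC⟩ : ∃ C : Fin 3 → Fin 3 → Fin 3 → ℝ, ∀ y ∈ U, ∀ c b f,
      conn g e c b f y = τ y * C c b f + if b = f then conn g e c 0 0 y * boost b else 0 := by
    -- The entries come from `conn g e 0 1 0 = -τ` and `conn g e 2 1 2 = τ`, together with their
    -- skew partners `conn g e 0 2 1 = -2τ` and `conn g e 2 0 1 = 2τ`.
    refine ⟨![![![0, 0, 0], ![-1, 0, 0], ![0, -2, 0]], 0, ![![0, 2, 0], ![0, 0, 1], 0]], ?_⟩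
    intro y hy c b f
    obtain ⟨v1, v2, v3, v4⟩ := conn_eq_zero hF h0 h1 hy (hne y hy)
    obtain ⟨t1, t2, t3, t4, t5, t6⟩ := hF.conn_table hy c
    have hby := hab y hy
    fin_cases c <;> simp only [Fin.zero_eta, Fin.mk_one, Fin.reduceFinMk] at * <;>
      fin_cases b <;> fin_cases f <;>
      simp [boost, t1, t2, t3, t4, t5, t6, v1, v2, v3, v4, hby, ← hτ] <;> ring
  set ι : Fin 4 → Fin 3 := fun i => a i.castSucc with hι
  set h : Fin 3 := a (Fin.last 4) with hh
  have hsum : ∀ y ∈ U, curvDeriv g 1 (fun i => e (a i)) y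
      = -(τ y * ∑ i, ∑ f, C h (ι i) f
        * curvDeriv g 0 (fun k => e (Function.update ι i f k)) y) := by
    intro y hy
    have e1 := hT.covDeriv_frame hF hy a
    have e2 : curvDeriv g 1 (fun i => e (a i)) y
      = dirDeriv (e h) (curvDeriv g 0 (fun i => e (ι i))) y
        - ∑ i : Fin 4, ∑ f, conn g e h (ι i) f y
          * curvDeriv g 0 (fun k => e (Function.update ι i f k)) y := e1
    have e3 : ∀ i : Fin 4, ∑ f, conn g e h (ι i) f y
          * curvDeriv g 0 (fun k => e (Function.update ι i f k)) y
        = τ y * ∑ f, C h (ι i) f * curvDeriv g 0 (fun k => e (Function.update ι i f k)) y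
          + conn g e h 0 0 y * (boost (ι i) * curvDeriv g 0 (fun k => e (ι k)) y) := by
      intro i
      rw [Finset.sum_congr rfl fun f _ => by rw [hC y hy]]
      simp only [add_mul, Finset.sum_add_distrib, ite_mul, zero_mul, Finset.sum_ite_eq,
        Finset.mem_univ, if_true, Function.update_eq_self, Finset.mul_sum, mul_assoc]
    -- An infinitesimal boost multiplies a component by its weight. Either the weight is zero or the
    -- component is, so the undetermined boost part of the connection drops out of ∇R.
    have e4 : (∑ i, boost (ι i) : ℝ) * curvDeriv g 0 (fun k => e (ι k)) y = 0 := by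
      by_cases hw : ∑ i, boost (ι i) = 0
      · have : (∑ i, boost (ι i) : ℝ) = ((∑ i, boost (ι i) : ℤ) : ℝ) := by push_cast; rfl
        rw [this, hw]; simp
      · rw [h0 y hy ι hw, mul_zero]
    rw [e2, hR y hy ι h, Finset.sum_congr rfl fun i _ => e3 i, Finset.sum_add_distrib,
      ← Finset.mul_sum, ← Finset.mul_sum, ← Finset.sum_mul, e4]
    ring
  rw [dirDeriv_congr hU hx hsum, dirDeriv_neg]
  have hK : HasDirDeriv U x (e k) (fun y => ∑ i, ∑ f, C h (ι i) f
        * curvDeriv g 0 (fun k => e (Function.update ι i f k)) y)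
      (∑ i : Fin 4, ∑ f, C h (ι i) f * 0) :=
    HasDirDeriv.sum _ (fun i => HasDirDeriv.sum _ (fun f => HasDirDeriv.const_mul
      ⟨hT.smooth fun k => hF.smoothField _, hR x hx (Function.update ι i f) k⟩ _ hU hx) hU hx) hU hx
  have hτd : HasDirDeriv U x (e k) τ 0 := ⟨hτs, hda x hx k⟩
  rw [(hτd.mul hK hU hx).2]
  simp

end LocallyConstant

/-! ### Lorentz matrices acting on tensor components, and their generators. -/

section LinearAlgebra

open Matrix

/-- Change of basis for the components of a covariant tensor. -/
def pullT {n : ℕ} (A : Matrix (Fin 3) (Fin 3) ℝ) (T : (Fin n → Fin 3) → ℝ) :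
    (Fin n → Fin 3) → ℝ :=
  fun a => ∑ b : Fin n → Fin 3, (∏ i, A (b i) (a i)) * T b

theorem pullT_pullT {n : ℕ} (A B : Matrix (Fin 3) (Fin 3) ℝ) (T : (Fin n → Fin 3) → ℝ) :
    pullT B (pullT A T) = pullT (A * B) T := by
  funext a
  simp only [pullT, Finset.mul_sum]
  rw [Finset.sum_comm]
  refine Finset.sum_congr rfl fun c _ => ?_
  simp only [Matrix.mul_apply, Finset.prod_univ_sum, Fintype.piFinset_univ, Finset.sum_mul,
    Finset.prod_mul_distrib]
  exact Finset.sum_congr rfl fun b _ => by ring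

theorem pullT_diagonal {n : ℕ} (d : Fin 3 → ℝ) (T : (Fin n → Fin 3) → ℝ) (a : Fin n → Fin 3) :
    pullT (diagonal d) T a = (∏ i, d (a i)) * T a := by
  rw [pullT, Finset.sum_eq_single a]
  · simp
  · intro b _ hb
    obtain ⟨i, hi⟩ := Function.ne_iff.1 hb
    have h0 : diagonal d (b i) (a i) = 0 := diagonal_apply_ne _ hi
    exact mul_eq_zero_of_left (Finset.prod_eq_zero (Finset.mem_univ i) h0) _
  · simp

/-- The Ricci contraction. -/
def ricT (T : (Fin 4 → Fin 3) → ℝ) : Matrix (Fin 3) (Fin 3) ℝ :=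
  of fun a b => ∑ c, ∑ d, etaInv c d * T ![d, a, c, b]

theorem sum_fin_four (F : (Fin 4 → Fin 3) → ℝ) :
    ∑ b, F b = ∑ p, ∑ q, ∑ r, ∑ s, F ![p, q, r, s] := by
  let φ : (Fin 4 → Fin 3) ≃ Fin 3 × Fin 3 × Fin 3 × Fin 3 :=
    { toFun := fun b => (b 0, b 1, b 2, b 3)
      invFun := fun p => ![p.1, p.2.1, p.2.2.1, p.2.2.2]
      left_inv := fun b => by
        funext i
        fin_cases i <;> rfl
      right_inv := fun p => rfl }
  rw [← φ.symm.sum_comp F]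
  simp only [Fintype.sum_prod_type]
  rfl

/-- The matrices preserving the Gram matrix `η`. -/
def IsLorentz (A : Matrix (Fin 3) (Fin 3) ℝ) : Prop := Aᵀ * eta * A = eta

namespace IsLorentz

variable {A B : Matrix (Fin 3) (Fin 3) ℝ}

theorem mul (hA : IsLorentz A) (hB : IsLorentz B) : IsLorentz (A * B) := by
  rw [IsLorentz, transpose_mul]
  calc Bᵀ * Aᵀ * eta * (A * B) = Bᵀ * (Aᵀ * eta * A) * B := by simp only [Matrix.mul_assoc]
    _ = eta := by rw [hA, hB]

theorem inverse_mul (hA : IsLorentz A) : etaInv * Aᵀ * eta * A = 1 := by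
  have h : etaInv * eta = 1 := mul_eq_one_comm.1 eta_mul_etaInv
  rw [Matrix.mul_assoc etaInv, Matrix.mul_assoc etaInv, hA, h]

theorem dual (hA : IsLorentz A) : A * etaInv * Aᵀ = etaInv := by
  have h := mul_eq_one_comm.1 hA.inverse_mul
  calc A * etaInv * Aᵀ = A * (etaInv * Aᵀ * eta) * etaInv := by
        simp only [Matrix.mul_assoc, eta_mul_etaInv, Matrix.mul_one]
    _ = etaInv := by rw [h, Matrix.one_mul]

/-- A Lorentz matrix as an invertible matrix. -/
def toGL (hA : IsLorentz A) : GL (Fin 3) ℝ where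
  val := A
  inv := etaInv * Aᵀ * eta
  val_inv := mul_eq_one_comm.1 hA.inverse_mul
  inv_val := hA.inverse_mul

theorem toGL_mem (hA : IsLorentz A) : hA.toGL ∈ lorentzGroup := hA

end IsLorentz

theorem sum_rotate (F : Fin 3 → Fin 3 → Fin 3 → Fin 3 → ℝ) :
    ∑ p, ∑ q, ∑ r, ∑ s, F p q r s = ∑ s, ∑ q, ∑ r, ∑ p, F p q r s := by
  rw [Finset.sum_comm, Finset.sum_congr rfl fun q _ => Finset.sum_comm,
    Finset.sum_congr rfl fun q _ => Finset.sum_congr rfl fun r _ => Finset.sum_comm,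
    Finset.sum_congr rfl fun q _ => Finset.sum_comm, Finset.sum_comm]

/-- In the contracted pair of indices the two factors `A` combine to A η⁻¹ Aᵀ, which is η⁻¹ by
`IsLorentz.dual`. -/
theorem ricT_pullT {A : Matrix (Fin 3) (Fin 3) ℝ} (hA : IsLorentz A) (T : (Fin 4 → Fin 3) → ℝ) :
    ricT (pullT A T) = Aᵀ * ricT T * A := by
  have hd : ∀ p r, ∑ c, ∑ d, etaInv c d * (A p d * A r c) = etaInv r p := by
    intro p r
    rw [← congrFun (congrFun hA.dual r) p]
    simp only [Matrix.mul_apply, Finset.sum_mul, transpose_apply]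
    rw [Finset.sum_comm]
    exact Finset.sum_congr rfl fun d _ => Finset.sum_congr rfl fun c _ => by ring
  ext a b
  have h1 : ricT (pullT A T) a b = ∑ p, ∑ q, ∑ r, ∑ s,
      (∑ c, ∑ d, etaInv c d * (A p d * A r c)) * (A q a * A s b * T ![p, q, r, s]) := by
    simp only [ricT, of_apply, pullT, sum_fin_four, Fin.prod_univ_four, Finset.mul_sum,
      Finset.sum_mul]
    rw [Finset.sum_congr rfl fun c _ => Finset.sum_comm, Finset.sum_comm]
    refine Finset.sum_congr rfl fun p _ => ?_
    rw [Finset.sum_congr rfl fun c _ => Finset.sum_comm, Finset.sum_comm]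
    refine Finset.sum_congr rfl fun q _ => ?_
    rw [Finset.sum_congr rfl fun c _ => Finset.sum_comm, Finset.sum_comm]
    refine Finset.sum_congr rfl fun r _ => ?_
    rw [Finset.sum_congr rfl fun c _ => Finset.sum_comm, Finset.sum_comm]
    refine Finset.sum_congr rfl fun s _ => ?_
    refine Finset.sum_congr rfl fun c _ => Finset.sum_congr rfl fun d _ => ?_
    simp only [Matrix.cons_val]
    ring
  rw [h1]
  rw [sum_rotate]
  simp only [hd, Matrix.mul_apply, ricT, of_apply, Finset.sum_mul, transpose_apply, Finset.mul_sum]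
  refine Finset.sum_congr rfl fun s _ => Finset.sum_congr rfl fun q _ =>
    Finset.sum_congr rfl fun r _ => Finset.sum_congr rfl fun p _ => ?_
  ring

open scoped Matrix.Norms.Operator in
/-- Infinitesimal version of invariance of a bilinear form. -/
theorem skew_of_exp_invariant {A N : Matrix (Fin 3) (Fin 3) ℝ}
    (h : ∀ t : ℝ, (NormedSpace.exp (t • A))ᵀ * N * NormedSpace.exp (t • A) = N) :
    Aᵀ * N + N * A = 0 := by
  have h1 := hasDerivAt_exp_smul_const (𝕂 := ℝ) A (0 : ℝ)
  have h2 := hasDerivAt_exp_smul_const (𝕂 := ℝ) Aᵀ (0 : ℝ)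
  have h3 := (h2.mul_const N).mul h1
  have h4 : (fun t : ℝ => NormedSpace.exp (t • Aᵀ) * N * NormedSpace.exp (t • A)) = fun _ => N := by
    funext t
    rw [← transpose_smul, exp_transpose, h t]
  have h5 := h3.unique (h4 ▸ hasDerivAt_const (0 : ℝ) N)
  simpa using h5

/-- If zero were the only generator, the span defining `lieDim` would be trivial. -/
theorem exists_generator {G : Subgroup (GL (Fin 3) ℝ)} (hG : 0 < lieDim G) :
    ∃ A : Matrix (Fin 3) (Fin 3) ℝ, A ≠ 0 ∧
      ∀ t : ℝ, ∃ X ∈ G, (X : Matrix (Fin 3) (Fin 3) ℝ) = NormedSpace.exp (t • A) := by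
  by_contra! hcon
  have : Submodule.span ℝ {A : Matrix (Fin 3) (Fin 3) ℝ |
      ∀ t : ℝ, ∃ X ∈ G, (X : Matrix (Fin 3) (Fin 3) ℝ) = NormedSpace.exp (t • A)} = ⊥ := by
    rw [Submodule.span_eq_bot]
    intro A hA
    by_contra hne
    obtain ⟨t, ht⟩ := hcon A hne
    obtain ⟨X, hX, hX'⟩ := hA t
    exact ht X hX hX'
  rw [lieDim, this] at hG
  simp at hG

end LinearAlgebra

/-! ### Normal form and infinitesimal stabilizer of a type D tensor. -/

section TypeD

open Matrix

/-- The canonical form of a type D Ricci tensor. -/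
structure IsCanonical (N : Matrix (Fin 3) (Fin 3) ℝ) : Prop where
  zero_zero : N 0 0 = 0
  zero_one : N 0 1 = 0
  one_zero : N 1 0 = 0
  one_two : N 1 2 = 0
  two_one : N 2 1 = 0
  two_two : N 2 2 = 0
  ne_zero : N 0 2 + 2 * N 1 1 ≠ 0

/-- The quartic at z is S(v, v) for the null vector v(z) = e₀ + 2z e₁ + z² e₂, so its double roots
are the two distinguished null directions. `N` and `S` differ by a multiple of η, and in canonical
form N₀₂ + 2N₁₁ = 3Ψ₂, which is nonzero because the roots are distinct. -/
theorem exists_isCanonical {N : Matrix (Fin 3) (Fin 3) ℝ} (hN : ∀ a b, N a b = N b a)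
    {S : Matrix (Fin 3) (Fin 3) ℝ} {s : ℝ} (hs : s = ∑ a, ∑ b, etaInv a b * N a b)
    (hS : ∀ a b, S a b = N a b - s / 3 * eta a b) (hne : S 2 2 ≠ 0) {α β : ℝ} (hαβ : α ≠ β)
    (hq : ∀ z, S 0 0 + 4 * S 0 1 * z + 6 * S 0 2 * z ^ 2 + 4 * S 1 2 * z ^ 3 + S 2 2 * z ^ 4
      = S 2 2 * ((z - α) ^ 2 * (z - β) ^ 2)) :
    ∃ Y, IsLorentz Y ∧ IsCanonical (Yᵀ * N * Y) := by
  have hd : α - β ≠ 0 := sub_ne_zero.2 hαβ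
  -- The leading coefficients already agree, so four values of z determine the other coefficients.
  have q0 := hq 0
  have q1 := hq 1
  have q2 := hq (-1)
  have q3 := hq 2
  simp only [Fin.sum_univ_three, etaInv] at hs
  simp [hN 1 0, hN 2 0, hN 2 1] at hs
  have s00 := hS 0 0
  have s01 := hS 0 1
  have s02 := hS 0 2
  have s12 := hS 1 2
  have s22 := hS 2 2
  simp [eta] at s00 s01 s02 s12 s22
  generalize hh : S 2 2 = h at *
  have n22 : N 2 2 = h := s22.symm
  have n12 : N 1 2 = -h * (α + β) / 2 := by linarith
  have n02 : N 0 2 = h * (α ^ 2 + β ^ 2 + 4 * α * β) / 6 - s / 3 := by linarith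
  have n01 : N 0 1 = -h * (α * β * (α + β)) / 2 := by linarith
  have n00 : N 0 0 = h * (α ^ 2 * β ^ 2) := by linarith
  have n11 : N 1 1 = h * (α ^ 2 + β ^ 2 + 4 * α * β) / 6 + s / 6 := by linarith
  have hNe : N = !![h * (α ^ 2 * β ^ 2), -h * (α * β * (α + β)) / 2,
      h * (α ^ 2 + β ^ 2 + 4 * α * β) / 6 - s / 3;
      -h * (α * β * (α + β)) / 2, h * (α ^ 2 + β ^ 2 + 4 * α * β) / 6 + s / 6, -h * (α + β) / 2;
      h * (α ^ 2 + β ^ 2 + 4 * α * β) / 6 - s / 3, -h * (α + β) / 2, h] := by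
    ext a b
    fin_cases a <;> fin_cases b <;>
      simp [n22, n12, n02, n01, n00, n11, hN 1 0, hN 2 0, hN 2 1]
  -- The columns are the new null triad: v(α), the vector e₀ + (α + β) e₁ + αβ e₂ orthogonal to both
  -- null directions, and v(β). The scaling follows from η(v(α), v(β)) = -(α - β)².
  refine ⟨!![1, 1 / (α - β), 1 / (α - β) ^ 2; 2 * α, (α + β) / (α - β), 2 * β / (α - β) ^ 2;
    α ^ 2, α * β / (α - β), β ^ 2 / (α - β) ^ 2], ?_, ?_⟩
  · rw [IsLorentz]
    ext a b
    fin_cases a <;> fin_cases b <;>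
      simp [Matrix.mul_apply, Fin.sum_univ_three, eta] <;> field_simp <;> ring
  · rw [hNe]
    constructor <;> simp only [Matrix.mul_apply, Fin.sum_univ_three, transpose_apply, of_apply,
      cons_val] <;> try (field_simp; ring1)
    have : h * (α - β) ^ 2 / 2 ≠ 0 := by positivity
    convert this using 1
    field_simp
    ring

/-- Invariance of `N` multiplies the two null-rotation parameters of `A` by N₀₂ + 2N₁₁. They vanish,
and only the boost parameter `A 0 0` survives. -/
theorem IsCanonical.eq_diagonal {N A : Matrix (Fin 3) (Fin 3) ℝ} (hN : IsCanonical N)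
    (h1 : Aᵀ * eta + eta * A = 0) (h2 : Aᵀ * N + N * A = 0) :
    A = diagonal (fun i => A 0 0 * boost i) := by
  have e1 := fun i j => congrFun (congrFun h1 i) j
  have e2 := fun i j => congrFun (congrFun h2 i) j
  have a00 := e1 0 0
  have a11 := e1 1 1
  have a22 := e1 2 2
  have a01 := e1 0 1
  have a02 := e1 0 2
  have a12 := e1 1 2
  have b01 := e2 0 1
  have b12 := e2 1 2
  simp [Matrix.mul_apply, Fin.sum_univ_three, eta, vecMul, dotProduct] at a00 a11 a22 a01 a02 a12
  simp [Matrix.mul_apply, Fin.sum_univ_three, hN.zero_zero, hN.zero_one, hN.one_zero,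
    hN.one_two, hN.two_one, hN.two_two] at b01 b12
  have c1 : A 2 1 = 0 := by
    have : A 2 1 * (N 0 2 + 2 * N 1 1) = 0 := by
      linear_combination b01 - 2 * N 1 1 * a01
    exact (mul_eq_zero.1 this).resolve_right hN.ne_zero
  have c2 : A 0 1 = 0 := by
    have : A 0 1 * (N 0 2 + 2 * N 1 1) = 0 := by
      linear_combination b12 - 2 * N 1 1 * a12
    exact (mul_eq_zero.1 this).resolve_right hN.ne_zero
  ext i j
  fin_cases i <;> fin_cases j <;> simp [boost] <;> linarith

theorem exp_diagonal_boost (t : ℝ) : NormedSpace.exp (diagonal fun i => t * (boost i : ℝ))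
    = diagonal (fun i : Fin 3 => Real.exp (t * boost i)) := by
  rw [Matrix.exp_diagonal]
  congr 1
  funext i
  rw [Pi.coe_exp, Real.exp_eq_exp_ℝ]

end TypeD

/-! ### Construction of the boost-invariant frame. -/

section BoostFrame

open Matrix

variable {M : Type*} [TopologicalSpace M] [ChartedSpace (EuclideanSpace ℝ (Fin 3)) M]
  [IsManifold (𝓡 3) ∞ M] {g : LorentzMetric M} {U : Set M} {e e' : Fin 3 → VField M} {x : M}

/-- The components of `∇^j R` at a point. -/
def curvT (g : LorentzMetric M) (j : ℕ) (e : Fin 3 → VField M) (x : M) :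
    (Fin (4 + j) → Fin 3) → ℝ :=
  fun a => curvDeriv g j (fun i => e (a i)) x

theorem curvT_eq_pullT (hF : IsMovingFrame g U e) (hF' : IsMovingFrame g U e') (hx : x ∈ U)
    (j : ℕ) {A : Matrix (Fin 3) (Fin 3) ℝ} (h : ∀ a, e' a x = ∑ b, A b a • e b x) :
    curvT g j e' x = pullT A (curvT g j e x) := by
  funext a
  exact (isTensorial_curvDeriv hF j).frame_expand hF (fun i => hF'.smoothField (a i)) hx
    (fun i b => A b (a i)) fun i => h (a i)

theorem ricci_eq_ricT (e : Fin 3 → VField M) (x : M) (a b : Fin 3) :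
    ricci g e x a b = ricT (curvT g 0 e x) a b := by
  simp only [ricci, ricT, of_apply]
  refine Finset.sum_congr rfl fun c _ => Finset.sum_congr rfl fun d _ => ?_
  rfl

namespace IsMovingFrame

theorem riem_pair_symm (hF : IsMovingFrame g U e) (hx : x ∈ U) (a b c d : Fin 3) :
    riem g e a b c d x = riem g e c d a b x := by
  linarith [hF.riem_bianchi hx a b c d, hF.riem_bianchi hx b c d a, hF.riem_bianchi hx c d a b,
    hF.riem_bianchi hx d a b c, hF.riem_swap_left hx b a d c, hF.riem_swap_left hx a c d b,
    hF.riem_swap_left hx b d a c, hF.riem_swap_left hx a d b c, hF.riem_swap_left hx b c a d,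
    hF.riem_swap_left hx b a c d, hF.riem_swap_left hx c d a b, hF.riem_swap_left hx d c b a,
    hF.riem_swap_right hx a b c d, hF.riem_swap_right hx b a c d, hF.riem_swap_right hx c d a b,
    hF.riem_swap_right hx d c a b, hF.riem_swap_right hx a c d b, hF.riem_swap_right hx c a d b,
    hF.riem_swap_right hx b d a c, hF.riem_swap_right hx d b a c, hF.riem_swap_right hx a d b c,
    hF.riem_swap_right hx d a b c, hF.riem_swap_right hx b c a d, hF.riem_swap_right hx c b a d,
    hF.riem_swap_left hx a b d c, hF.riem_swap_left hx c a b d, hF.riem_swap_left hx c b d a]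

theorem ricT_table (e : Fin 3 → VField M) (x : M) (a b : Fin 3) :
    ricT (curvT g 0 e x) a b
      = -riem g e 2 a 0 b x - riem g e 0 a 2 b x + 2 * riem g e 1 a 1 b x := by
  simp only [ricT, of_apply, Fin.sum_univ_three, riem_eq_curvDeriv, curvT]
  simp [etaInv]
  ring

theorem ricT_symm (hF : IsMovingFrame g U e) (hx : x ∈ U) (a b : Fin 3) :
    ricT (curvT g 0 e x) a b = ricT (curvT g 0 e x) b a := by
  rw [ricT_table, ricT_table, hF.riem_pair_symm hx 2 a 0 b, hF.riem_pair_symm hx 0 a 2 b,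
    hF.riem_pair_symm hx 1 a 1 b]
  ring

theorem exists_isLorentz (hF : IsMovingFrame g U e) (hF' : IsMovingFrame g U e') (hx : x ∈ U) :
    ∃ X, IsLorentz X ∧ ∀ a, e' a x = ∑ b, X b a • e b x := by
  choose c hc using fun a => g.exists_coord (hF.orthonormal x hx) (e' a x)
  refine ⟨of fun b a => c a b, ?_, fun a => hc a⟩
  ext a b
  rw [← hF'.orthonormal x hx a b, hc a, hc b]
  simp only [map_sum, map_smul, _root_.sum_apply, _root_.smul_apply, smul_eq_mul, hF.orthonormal x hx,
    Matrix.mul_apply, transpose_apply, of_apply, Finset.sum_mul, Finset.mul_sum]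
  exact Finset.sum_congr rfl fun i _ => Finset.sum_congr rfl fun j _ => by ring

/-- A constant Lorentz transformation of a moving frame. -/
theorem change (hF : IsMovingFrame g U e) {X : Matrix (Fin 3) (Fin 3) ℝ} (hX : IsLorentz X) :
    IsMovingFrame g U (fun a => ∑ b, X b a • e b) where
  isOpen := hF.isOpen
  smooth a := SmoothField.sum fun b _ => (hF.smoothField b).const_smul (X b a)
  orthonormal x hx a b := by
    rw [← congrFun (congrFun hX a) b]
    simp only [Finset.sum_apply, Pi.smul_apply, map_sum, map_smul, _root_.sum_apply, _root_.smul_apply,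
      smul_eq_mul, hF.orthonormal x hx, Matrix.mul_apply, transpose_apply, Finset.sum_mul,
      Finset.mul_sum]
    exact Finset.sum_congr rfl fun i _ => Finset.sum_congr rfl fun j _ => by ring

end IsMovingFrame

/-- The frame witnessing type D need not be the given one. The two are related at `x` by a Lorentz
matrix, which is absorbed into the normalizing transformation. -/
theorem IsTypeDAt.exists_isCanonical (hD : IsTypeDAt g x) (hF : IsMovingFrame g U e) (hx : x ∈ U) :
    ∃ X, IsLorentz X ∧ IsCanonical (Xᵀ * ricT (curvT g 0 e x) * X) := by
  obtain ⟨V, f, hf, hxV, hne, α, β, hαβ, hq⟩ := hD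
  obtain ⟨Y, hY, hc⟩ := CurvHom.exists_isCanonical (N := ricT (curvT g 0 f x))
    (hf.ricT_symm hxV) (S := tfRicci g f x) (s := scalarCurv g f x)
    (by simp only [scalarCurv, ricci_eq_ricT]) (fun a b => by rw [tfRicci, ricci_eq_ricT])
    hne hαβ hq
  have hW : IsOpen (U ∩ V) := hF.isOpen.inter hf.isOpen
  have hF' := hF.mono hW Set.inter_subset_left
  have hf' := hf.mono hW Set.inter_subset_right
  obtain ⟨Z, hZ, hZe⟩ := hF'.exists_isLorentz hf' ⟨hx, hxV⟩
  refine ⟨Z * Y, hZ.mul hY, ?_⟩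
  rw [curvT_eq_pullT hF' hf' ⟨hx, hxV⟩ 0 hZe] at hc
  rw [show ricT (pullT Z (curvT g 0 e x)) = Zᵀ * ricT (curvT g 0 e x) * Z from
    ricT_pullT hZ _] at hc
  convert hc using 1
  simp only [transpose_mul, Matrix.mul_assoc]

/-- If a group of positive dimension fixes the components of `R` and `∇R`, some constant Lorentz
transformation of the frame makes them boost-invariant. -/
theorem exists_boostInvariant_frame (hF : IsMovingFrame g U e) (hx : x ∈ U) (hD : IsTypeDAt g x)
    {G : Subgroup (GL (Fin 3) ℝ)} (hG : G ≤ lorentzGroup) (hdim : 0 < lieDim G)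
    (h0 : ∀ X ∈ G, ∀ y ∈ U, pullT (X : Matrix (Fin 3) (Fin 3) ℝ) (curvT g 0 e y) = curvT g 0 e y)
    (h1 : ∀ X ∈ G, ∀ y ∈ U, pullT (X : Matrix (Fin 3) (Fin 3) ℝ) (curvT g 1 e y) = curvT g 1 e y) :
    ∃ e', IsMovingFrame g U e' ∧ BoostInvariant g U e' 0 ∧ BoostInvariant g U e' 1 ∧
      riem g e' 0 2 0 2 x + 2 * riem g e' 0 1 1 2 x ≠ 0 := by
  obtain ⟨A, hA0, hA⟩ := exists_generator hdim
  obtain ⟨X, hX, hc⟩ := hD.exists_isCanonical hF hx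
  have hF' := hF.change hX
  set e' : Fin 3 → VField M := fun a => ∑ b, X b a • e b with he'
  have hXu : IsUnit X := ⟨hX.toGL, rfl⟩
  have hdet : IsUnit X.det := (Matrix.isUnit_iff_isUnit_det X).1 hXu
  have hXi : X * X⁻¹ = 1 := Matrix.mul_nonsing_inv X hdet
  have hpull : ∀ y ∈ U, ∀ j, curvT g j e' y = pullT X (curvT g j e y) := fun y hy j =>
    curvT_eq_pullT hF hF' hy j fun a => by simp [he']
  -- This is the generator as seen from the new frame.
  set B := X⁻¹ * A * X with hB
  have hexp : ∀ t : ℝ, NormedSpace.exp (t • B) = X⁻¹ * NormedSpace.exp (t • A) * X := by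
    intro t
    rw [← Matrix.exp_conj' X _ hXu, hB]
    simp
  have hXe : ∀ t : ℝ, X * NormedSpace.exp (t • B) = NormedSpace.exp (t • A) * X := by
    intro t
    rw [hexp, ← Matrix.mul_assoc, ← Matrix.mul_assoc, hXi, Matrix.one_mul]
  have hfix : ∀ j, (∀ Z ∈ G, ∀ y ∈ U,
      pullT (Z : Matrix (Fin 3) (Fin 3) ℝ) (curvT g j e y) = curvT g j e y) →
      ∀ t : ℝ, ∀ y ∈ U, pullT (NormedSpace.exp (t • B)) (curvT g j e' y) = curvT g j e' y := by
    intro j hj t y hy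
    obtain ⟨Z, hZ, hZA⟩ := hA t
    rw [hpull y hy, pullT_pullT, hXe, ← pullT_pullT, ← hZA, hj Z hZ y hy]
  have hlor : ∀ t : ℝ, IsLorentz (NormedSpace.exp (t • B)) := by
    intro t
    obtain ⟨Z, hZ, hZA⟩ := hA t
    have hZL : IsLorentz (NormedSpace.exp (t • A)) := by rw [← hZA]; exact hG hZ
    have h2 := hZL.mul hX
    rw [← hXe] at h2
    rw [IsLorentz, transpose_mul] at h2
    have h3 : (NormedSpace.exp (t • B))ᵀ * (Xᵀ * eta * X) * NormedSpace.exp (t • B) = eta := by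
      simpa only [Matrix.mul_assoc] using h2
    rwa [hX] at h3
  have hric : ricT (curvT g 0 e' x) = Xᵀ * ricT (curvT g 0 e x) * X := by
    rw [hpull x hx 0]
    exact ricT_pullT hX _
  rw [← hric] at hc
  -- The Ricci tensor is known to be canonical at `x` only, but `B` is a constant matrix, so
  -- recognizing it as a boost there gives boost invariance on all of `U`.
  obtain ⟨l, hBd⟩ : ∃ l : ℝ, B = diagonal (fun i => l * boost i) := by
    refine ⟨_, hc.eq_diagonal (skew_of_exp_invariant fun t => hlor t) (skew_of_exp_invariant fun t => ?_)⟩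
    rw [← show ricT (pullT (NormedSpace.exp (t • B)) (curvT g 0 e' x)) = _ from
      ricT_pullT (hlor t) _, hfix 0 h0 t x hx]
  have hl : l ≠ 0 := by
    intro hz
    rw [hz] at hBd
    simp only [zero_mul, diagonal_zero] at hBd
    have : A = X * B * X⁻¹ := by
      rw [hB, ← Matrix.mul_assoc, ← Matrix.mul_assoc, hXi, Matrix.one_mul, Matrix.mul_assoc, hXi,
        Matrix.mul_one]
    rw [hBd] at this
    exact hA0 (by simpa using this)
  have hboost : ∀ j, (∀ Z ∈ G, ∀ y ∈ U,
      pullT (Z : Matrix (Fin 3) (Fin 3) ℝ) (curvT g j e y) = curvT g j e y) →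
      BoostInvariant g U e' j := by
    intro j hj y hy a ha
    -- At parameter `l⁻¹` the group element is the boost diag(e, 1, e⁻¹). It multiplies a component
    -- of weight w by e^w, which differs from 1 unless w = 0.
    have h2 := congrFun (hfix j hj (l)⁻¹ y hy) a
    have h3 : (l)⁻¹ • B = diagonal fun i => (1 : ℝ) * (boost i : ℝ) := by
      rw [hBd]
      ext i k
      rcases eq_or_ne i k with rfl | hik
      · simp [hl]
      · simp [hik]
    rw [h3, exp_diagonal_boost, pullT_diagonal, ← Real.exp_sum] at h2
    have h4 : ∑ i, (1 : ℝ) * (boost (a i) : ℝ) = ((∑ i, boost (a i) : ℤ) : ℝ) := by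
      push_cast
      simp
    rw [h4] at h2
    have h5 : Real.exp ((∑ i, boost (a i) : ℤ) : ℝ) ≠ 1 := by
      rw [Ne, Real.exp_eq_one_iff]
      exact_mod_cast ha
    have h6 : (Real.exp ((∑ i, boost (a i) : ℤ) : ℝ) - 1) * curvT g j e' y a = 0 := by
      linear_combination h2
    exact (mul_eq_zero.1 h6).resolve_left (sub_ne_zero.2 h5)
  refine ⟨e', hF', hboost 0 h0, hboost 1 h1, ?_⟩
  -- In terms of curvature, N₀₂ = R₀₂₀₂ - 2R₀₁₁₂ and N₁₁ = 2R₀₁₁₂.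
  convert hc.ne_zero using 1
  rw [IsMovingFrame.ricT_table, IsMovingFrame.ricT_table]
  have t1 := hF'.riem_swap_left hx 2 0 0 2
  have t2 := hF'.riem_swap_right hx 0 0 2 2
  have t3 := hF'.riem_swap_left hx 1 0 1 2
  have t4 := hF'.riem_swap_left hx 2 1 0 1
  have t5 := hF'.riem_swap_right hx 0 1 2 1
  have t6 := hF'.riem_swap_left hx 1 1 1 1
  have t7 := hF'.riem_pair_symm hx 1 2 0 1
  linarith

end BoostFrame

/-! ### Curvature homogeneity, transfer between frames, and the contradiction. -/

section Nonexistence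

open Matrix

variable {M : Type*} [TopologicalSpace M] [ChartedSpace (EuclideanSpace ℝ (Fin 3)) M]
  [IsManifold (𝓡 3) ∞ M] {g : LorentzMetric M} {U V : Set M} {e f : Fin 3 → VField M} {x : M}

theorem IsMovingFrame.smoothFn_curvT (hF : IsMovingFrame g U e) (j : ℕ) (a : Fin (4 + j) → Fin 3) :
    SmoothFn U (fun y => curvT g j e y a) :=
  (isTensorial_curvDeriv hF j).smooth fun i => hF.smoothField (a i)

theorem IsMovingFrame.mvfderiv_curvT_eq_zero (hF : IsMovingFrame g U e) (hx : x ∈ U) {p : ℕ}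
    (h : mvfderiv (𝓡 3) (curvComp g p e) x = 0) (j : Fin (p + 1))
    (a : Fin (4 + (j : ℕ)) → Fin 3) :
    mvfderiv (𝓡 3) (fun y => curvT g j e y a) x = 0 := by
  have hs : MDifferentiableAt (𝓡 3) 𝓘(ℝ, CurvSpace p) (curvComp g p e) x := by
    refine ContMDiffAt.mdifferentiableAt (n := ∞) ?_ (by simp)
    rw [contMDiffAt_pi_space]
    intro j
    rw [contMDiffAt_pi_space]
    intro a
    exact (hF.smoothFn_curvT j a).contMDiffAt hF.isOpen hx
  let L : CurvSpace p →L[ℝ] ℝ := (ContinuousLinearMap.proj a).comp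
    (ContinuousLinearMap.proj (R := ℝ) (φ := fun j : Fin (p + 1) => (Fin (4 + (j : ℕ)) → Fin 3) → ℝ)
      j)
  have h1 : HasMFDerivAt (𝓡 3) 𝓘(ℝ, CurvSpace p) (curvComp g p e) x
      (0 : TangentSpace (𝓡 3) x →L[ℝ] CurvSpace p) := by
    have h0 : mfderiv (𝓡 3) 𝓘(ℝ, CurvSpace p) (curvComp g p e) x
      = (0 : TangentSpace (𝓡 3) x →L[ℝ] CurvSpace p) := h
    have := hs.hasMFDerivAt
    rwa [h0] at this
  have h2 := (L.hasMFDerivAt (x := curvComp g p e x)).comp x h1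
  have h3 := h2.mfderiv
  have h4 : L.comp (0 : TangentSpace (𝓡 3) x →L[ℝ] CurvSpace p) = 0 := L.comp_zero
  exact h3.trans h4

theorem mvfderiv_eq_zero_of_eventually_eq {W : Type*} [NormedAddCommGroup W] [NormedSpace ℝ W]
    {F : M → W} (h : ∀ᶠ y in nhds x, F y = F x) : mvfderiv (𝓡 3) F x = 0 := by
  have he : F =ᶠ[nhds x] fun _ => F x := h
  have h1 := he.mfderiv_eq (I := 𝓡 3) (I' := 𝓘(ℝ, W))
  have h2 : mvfderiv (𝓡 3) (fun _ : M => F x) x = 0 := mvfderiv_const _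
  rw [← h2]
  exact h1

/-- Around every point of a curvature homogeneous manifold of order zero there is a moving frame in
which the curvature components are constant. -/
theorem HasHorizontalRank.exists_frame (h : HasHorizontalRank g 0 0) (x : M) :
    ∃ (V : Set M) (f : Fin 3 → VField M), IsMovingFrame g V f ∧ x ∈ V ∧
      ∀ y ∈ V, curvT g 0 f y = curvT g 0 f x := by
  obtain ⟨S, G, hN, hmax⟩ := h
  obtain ⟨V, f, hf, hx, hS⟩ := hN.cover x
  have hd : ∀ y ∈ V, mvfderiv (𝓡 3) (curvComp g 0 f) y = 0 := by
    intro y hy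
    have h1 := hmax.2 ⟨V, f, hf, hS, y, hy, rfl⟩
    have h2 := Submodule.finrank_eq_zero.1 (Nat.le_zero.1 h1)
    have h3 := LinearMap.range_eq_bot.1 h2
    ext1 v
    exact DFunLike.congr_fun h3 v
  have h1 : ∀ᶠ y in nhds x, ∀ a, curvT g 0 f y a = curvT g 0 f x a := by
    rw [Filter.eventually_all]
    intro a
    exact eventually_eq_of_mvfderiv_eq_zero hf.isOpen hx (hf.smoothFn_curvT 0 a) fun y hy =>
      hf.mvfderiv_curvT_eq_zero hy (hd y hy) 0 a
  obtain ⟨W, hW, hWo, hxW⟩ := eventually_nhds_iff.1 h1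
  exact ⟨V ∩ W, f, hf.mono (hf.isOpen.inter hWo) Set.inter_subset_left, ⟨hx, hxW⟩,
    fun y hy => funext (hW y hy.2)⟩

/-- These scalar invariants carry constancy from the curvature-homogeneous frame to the
boost-invariant one, although the two frames are related by a variable Lorentz matrix. -/
theorem trace_ricT_pullT {A : Matrix (Fin 3) (Fin 3) ℝ} (hA : IsLorentz A)
    (T : (Fin 4 → Fin 3) → ℝ) :
    trace (etaInv * ricT (pullT A T)) = trace (etaInv * ricT T) ∧
    trace (etaInv * ricT (pullT A T) * (etaInv * ricT (pullT A T)))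
      = trace (etaInv * ricT T * (etaInv * ricT T)) := by
  rw [ricT_pullT hA]
  constructor
  · calc _ = trace ((etaInv * Aᵀ * ricT T) * A) := by simp only [Matrix.mul_assoc]
      _ = trace ((A * etaInv * Aᵀ) * ricT T) := by
          rw [trace_mul_comm]
          simp only [Matrix.mul_assoc]
      _ = _ := by rw [hA.dual]
  · calc _ = trace ((etaInv * Aᵀ * ricT T * (A * etaInv * Aᵀ) * ricT T) * A) := by
          simp only [Matrix.mul_assoc]
      _ = trace ((A * etaInv * Aᵀ) * ricT T * ((A * etaInv * Aᵀ) * ricT T)) := by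
          rw [trace_mul_comm]
          simp only [Matrix.mul_assoc]
      _ = _ := by rw [hA.dual]

/-- With P = R₀₁₁₂ and Q = R₀₂₀₂, the invariants are -2Q + 8P and 2(Q - 2P)² + 16P². Their Jacobian
with respect to (P, Q) is 16(Q + 2P), which is nonzero at `x`, so constancy of the invariants kills
the derivatives of P and Q. -/
theorem BoostInvariant.dirDeriv_eq_zero (hF : IsMovingFrame g U e) (h0 : BoostInvariant g U e 0)
    (hx : x ∈ U) (hne : riem g e 0 2 0 2 x + 2 * riem g e 0 1 1 2 x ≠ 0)
    (hf : IsMovingFrame g V f) (hxV : x ∈ V) (hc : ∀ y ∈ V, curvT g 0 f y = curvT g 0 f x)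
    (X : VField M) :
    dirDeriv X (riem g e 0 1 1 2) x = 0 ∧ dirDeriv X (riem g e 0 2 0 2) x = 0 := by
  have hW : IsOpen (V ∩ U) := hf.isOpen.inter hF.isOpen
  have hf' := hf.mono hW Set.inter_subset_left
  have hF' := hF.mono hW Set.inter_subset_right
  have hxW : x ∈ V ∩ U := ⟨hxV, hx⟩
  have htr : ∀ y ∈ V ∩ U,
      trace (etaInv * ricT (curvT g 0 e y)) = trace (etaInv * ricT (curvT g 0 f x)) ∧
      trace (etaInv * ricT (curvT g 0 e y) * (etaInv * ricT (curvT g 0 e y)))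
        = trace (etaInv * ricT (curvT g 0 f x) * (etaInv * ricT (curvT g 0 f x))) := by
    intro y hy
    obtain ⟨Z, hZ, hZe⟩ := hf'.exists_isLorentz hF' hy
    rw [curvT_eq_pullT hf' hF' hy 0 hZe, hc y hy.1]
    exact trace_ricT_pullT hZ _
  have hval : ∀ y ∈ V ∩ U, trace (etaInv * ricT (curvT g 0 e y))
        = -2 * riem g e 0 2 0 2 y + 8 * riem g e 0 1 1 2 y ∧
      trace (etaInv * ricT (curvT g 0 e y) * (etaInv * ricT (curvT g 0 e y)))
        = 2 * ((riem g e 0 2 0 2 y + -2 * riem g e 0 1 1 2 y)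
            * (riem g e 0 2 0 2 y + -2 * riem g e 0 1 1 2 y))
          + 16 * (riem g e 0 1 1 2 y * riem g e 0 1 1 2 y) := by
    intro y hy
    have hz := fun a b c d hw => h0.riem_eq_zero hy.2 a b c d hw
    have hr : ∀ a b, boost a + boost b ≠ 0 → ricT (curvT g 0 e y) a b = 0 := by
      intro a b hab
      rw [IsMovingFrame.ricT_table, hz 2 a 0 b (by simpa [boost] using hab),
        hz 0 a 2 b (by simpa [boost] using hab), hz 1 a 1 b (by simpa [boost] using hab)]
      simp
    have r02 : ricT (curvT g 0 e y) 0 2 = riem g e 0 2 0 2 y - 2 * riem g e 0 1 1 2 y := by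
      rw [IsMovingFrame.ricT_table]
      linarith [hF.riem_swap_left hy.2 2 0 0 2, hF.riem_swap_right hy.2 0 0 2 2,
        hF.riem_swap_left hy.2 1 0 1 2]
    have r11 : ricT (curvT g 0 e y) 1 1 = 2 * riem g e 0 1 1 2 y := by
      rw [IsMovingFrame.ricT_table]
      linarith [hF.riem_swap_left hy.2 2 1 0 1, hF.riem_swap_right hy.2 0 1 2 1,
        hF.riem_swap_left hy.2 1 1 1 1, hF.riem_pair_symm hy.2 1 2 0 1]
    have r20 := hF.ricT_symm hy.2 2 0
    rw [r02] at r20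
    simp [trace_fin_three, Matrix.mul_apply, Fin.sum_univ_three, etaInv, vecMul, dotProduct, r02,
      r11, r20, hr 0 0 (by decide), hr 0 1 (by decide), hr 1 0 (by decide), hr 1 2 (by decide),
      hr 2 1 (by decide), hr 2 2 (by decide)]
    constructor <;> ring
  have sP : HasDirDeriv (V ∩ U) x X (riem g e 0 1 1 2) _ := ⟨hF'.smoothFn_riem 0 1 1 2, rfl⟩
  have sQ : HasDirDeriv (V ∩ U) x X (riem g e 0 2 0 2) _ := ⟨hF'.smoothFn_riem 0 2 0 2, rfl⟩
  have k1 := ((sQ.const_mul (-2) hW hxW).add (sP.const_mul 8 hW hxW) hW hxW).2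
  have sB := sQ.add (sP.const_mul (-2) hW hxW) hW hxW
  have k2 := (((sB.mul sB hW hxW).const_mul 2 hW hxW).add
    ((sP.mul sP hW hxW).const_mul 16 hW hxW) hW hxW).2
  rw [dirDeriv_eq_zero_of_const hW hxW fun y hy => (hval y hy).1.symm.trans (htr y hy).1] at k1
  rw [dirDeriv_eq_zero_of_const hW hxW fun y hy => (hval y hy).2.symm.trans (htr y hy).2] at k2
  have hP : dirDeriv X (riem g e 0 1 1 2) x = 0 := by
    have : (riem g e 0 2 0 2 x + 2 * riem g e 0 1 1 2 x) * dirDeriv X (riem g e 0 1 1 2) x = 0 := by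
      linear_combination (-1 / 8) * k2 + (-1 / 4) * (riem g e 0 2 0 2 x - 2 * riem g e 0 1 1 2 x) * k1
    exact (mul_eq_zero.1 this).resolve_left hne
  refine ⟨hP, ?_⟩
  rw [hP] at k1
  linarith

/-- The components in `f` at `x` and at a nearby point are both Lorentz transforms of the same
constant array, so they lie in one orbit and both belong to `S`. By (N2) the transformation between
them is in `G`, and by (N1) it acts trivially. -/
theorem IsNormalizing.eventually_const {p : ℕ} {S : Set (CurvSpace p)} {G : Subgroup (GL (Fin 3) ℝ)}
    (hN : IsNormalizing g p S G) (hf : IsMovingFrame g V f) (hxV : x ∈ V)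
    (hS : ∀ y ∈ V, curvComp g p f y ∈ S) (hF : IsMovingFrame g U e) (hx : x ∈ U)
    (hc : ∀ᶠ y in nhds x, curvComp g p e y = curvComp g p e x) :
    ∀ᶠ y in nhds x, curvComp g p f y = curvComp g p f x := by
  have hW : IsOpen (U ∩ V) := hF.isOpen.inter hf.isOpen
  have hF' := hF.mono hW Set.inter_subset_left
  have hf' := hf.mono hW Set.inter_subset_right
  obtain ⟨X, hX, hXe⟩ := hF'.exists_isLorentz hf' ⟨hx, hxV⟩
  filter_upwards [hc, hW.mem_nhds ⟨hx, hxV⟩] with y hy hyW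
  obtain ⟨Y, hY, hYe⟩ := hF'.exists_isLorentz hf' hyW
  have h1 := curvComp_eq_pull hF' hf' ⟨hx, hxV⟩ p X hXe
  have h2 := curvComp_eq_pull hF' hf' hyW p Y hYe
  have h3 : act (hY.toGL⁻¹ * hX.toGL) (curvComp g p f x) = curvComp g p f y := by
    rw [h1, h2, hy]
    funext j
    have hXi : X * ((hX.toGL⁻¹ : GL (Fin 3) ℝ) : Matrix (Fin 3) (Fin 3) ℝ) = 1 := hX.toGL.mul_inv
    have hm : X * (((hY.toGL⁻¹ * hX.toGL)⁻¹ : GL (Fin 3) ℝ) : Matrix (Fin 3) (Fin 3) ℝ) = Y := by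
      rw [_root_.mul_inv_rev, inv_inv, Units.val_mul, ← Matrix.mul_assoc, hXi, Matrix.one_mul]
      rfl
    refine (pullT_pullT X _ (curvComp g p e x j)).trans ?_
    rw [hm]
    rfl
  have hZ : hY.toGL⁻¹ * hX.toGL ∈ lorentzGroup :=
    lorentzGroup.mul_mem (lorentzGroup.inv_mem hY.toGL_mem) hX.toGL_mem
  have hZG := hN.maximal _ hZ ⟨_, ⟨_, hS x hxV, rfl⟩, h3 ▸ hS y hyW.2⟩
  rw [← h3]
  exact hN.fixes _ hZG _ (hS x hxV)

theorem IsNormalizing.pullT_curvT {p : ℕ} {S : Set (CurvSpace p)} {G : Subgroup (GL (Fin 3) ℝ)}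
    (hN : IsNormalizing g p S G) (hS : curvComp g p e x ∈ S) {j : ℕ} (hj : j ≤ p)
    {X : GL (Fin 3) ℝ} (hX : X ∈ G) :
    pullT (X : Matrix (Fin 3) (Fin 3) ℝ) (curvT g j e x) = curvT g j e x := by
  -- `act` pulls back by the inverse matrix, so (N1) is applied to X⁻¹.
  have h := congrFun (hN.fixes _ (G.inv_mem hX) _ hS) ⟨j, Nat.lt_succ_of_le hj⟩
  rw [act, inv_inv] at h
  exact h

/-- Boost-invariant frames of first order on a curvature homogeneous manifold. -/
theorem BoostInvariant.eventually_curvComp_eq (hCH : HasHorizontalRank g 0 0)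
    (hF : IsMovingFrame g U e) (h0 : BoostInvariant g U e 0) (h1 : BoostInvariant g U e 1)
    (hx : x ∈ U) (hne : riem g e 0 2 0 2 x + 2 * riem g e 0 1 1 2 x ≠ 0) :
    ∀ᶠ y in nhds x, curvComp g 1 e y = curvComp g 1 e x := by
  -- Nondegeneracy is given only at `x`. It is an open condition and holds on this smaller
  -- neighbourhood.
  set W := U ∩ (fun y => riem g e 0 2 0 2 y + 2 * riem g e 0 1 1 2 y) ⁻¹' {0}ᶜ with hWdef
  have hs : SmoothFn U (fun y => riem g e 0 2 0 2 y + 2 * riem g e 0 1 1 2 y) :=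
    (hF.smoothFn_riem 0 2 0 2).add ((smoothFn_const 2).mul (hF.smoothFn_riem 0 1 1 2))
  have hW : IsOpen W := (ContMDiffOn.continuousOn hs).isOpen_inter_preimage hF.isOpen
    isOpen_compl_singleton
  have hWU : W ⊆ U := Set.inter_subset_left
  have hF' := hF.mono hW hWU
  have h0' : BoostInvariant g W e 0 := fun y hy => h0 y (hWU hy)
  have h1' : BoostInvariant g W e 1 := fun y hy => h1 y (hWU hy)
  have hne' : ∀ y ∈ W, riem g e 0 2 0 2 y + 2 * riem g e 0 1 1 2 y ≠ 0 := fun y hy => hy.2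
  have hxW : x ∈ W := ⟨hx, hne⟩
  have hPQ : ∀ y ∈ W, ∀ c, dirDeriv (e c) (riem g e 0 1 1 2) y = 0 ∧
      dirDeriv (e c) (riem g e 0 2 0 2) y = 0 := by
    intro y hy c
    obtain ⟨V, f, hf, hyV, hc⟩ := hCH.exists_frame y
    exact h0'.dirDeriv_eq_zero hF' hy (hne' y hy) hf hyV hc (e c)
  have key : ∀ (j : Fin 2) (a : Fin (4 + (j : ℕ)) → Fin 3),
      ∀ᶠ y in nhds x, curvComp g 1 e y j a = curvComp g 1 e x j a := by
    intro j a
    refine hF'.eventually_eq hxW (hF'.smoothFn_curvT j a) fun y hy c => ?_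
    fin_cases j
    · exact h0'.dirDeriv_riem hF' hy (e c) (hPQ y hy c).1 (hPQ y hy c).2 (a 0) (a 1) (a 2) (a 3)
    · exact h0'.dirDeriv_curvDeriv_one hF' h1' hne' (fun z hz c => (hPQ z hz c).1)
        (fun z hz c => (hPQ z hz c).2) hy a c
  have key' : ∀ᶠ y in nhds x, ∀ j a, curvComp g 1 e y j a = curvComp g 1 e x j a := by
    rw [Filter.eventually_all]
    intro j
    rw [Filter.eventually_all]
    exact key j
  filter_upwards [key'] with y hy
  funext j a
  exact hy j a

end Nonexistence

end

end CurvHom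

theorem mainTheorem10 {M : Type*} [TopologicalSpace M] [T2Space M] [SecondCountableTopology M]
    [Nonempty M] [ChartedSpace (EuclideanSpace ℝ (Fin 3)) M] [IsManifold (𝓡 3) ∞ M]
    (g : CurvHom.LorentzMetric M) :
    ¬ (CurvHom.IsTypeD g ∧ CurvHom.IsProperlyCH g 0 ∧ ∃ k : ℕ, CurvHom.PseudoStable g k) := by
  rintro ⟨hD, ⟨⟨-, -, hCH⟩, t, ht, S₁, G₁, hN₁, hmax⟩, k, -, -, hk, s, s', q, ⟨S, G, hN, hG⟩, -, -,
    -, hs⟩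
  -- At this point the components of first order attain their positive rank `t`.
  obtain ⟨V, f, hf, hS₁, x, hxV, hrank⟩ := hmax.1
  obtain ⟨U, e, hF, hx, hS⟩ := hN.cover x
  -- The dimension is positive because it exceeds `s'`, and since `k ≥ 1` the group of order `k`
  -- fixes both R and ∇R.
  obtain ⟨e', hF', h0, h1, hne⟩ := CurvHom.exists_boostInvariant_frame hF hx (hD x) hN.le (by omega)
    (fun X hX y hy => hN.pullT_curvT (hS y hy) (Nat.zero_le k) hX)
    (fun X hX y hy => hN.pullT_curvT (hS y hy) hk hX)
  have hc := h0.eventually_curvComp_eq hCH hF' h1 hx hne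
  -- Constancy passes from the boost-invariant frame to `f`, a normalizing frame of order one, where
  -- it contradicts the rank.
  have hz := CurvHom.mvfderiv_eq_zero_of_eventually_eq
    (hN₁.eventually_const hf hxV hS₁ hF' hx hc)
  have h2 : Module.finrank ℝ
      (LinearMap.range (mvfderiv (𝓡 3) (CurvHom.curvComp g (0 + 1) f) x).toLinearMap) = 0 := by
    rw [hz]
    simp
  omega
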